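/- **Model.** A time-slotted system has one dispatcher and $N$ parallel queues with lengths $Q_n(t)$. In slot $t$, $A_\Sigma(t)$ jobs arrive (nonnegative-integer valued, i.i.d. over time, bounded), all of them are sent to one queue $s$ chosen by the policy ($A_s(t)=A_\Sigma(t)$, $A_n(t)=0$ for $n\ne s$), and $$Q_n(t+1)=[Q_n(t)+A_n(t)-S_n(t)]^+ = Q_n(t)+A_n(t)-S_n(t)+U_n(t),$$ where the offered services $S_n(t)$ are bounded, nonnegative-integer valued, i.i.d. over time, independent over $n$ and of the arrivals, and $U_n(t)=\max(S_n(t)-Q_n(t)-A_n(t),0)$ is the unused service. Servers are homogeneous if the $S_n(t)$ have a common law. Let $\mu_\Sigma=\sum_n\mathbb E[S_n(t)]$. The arrivals $A_\Sigma^{(\epsilon)}$, for small $\epsilon>0$, have mean $\mu_\Sigma-\epsilon$ and variance $(\sigma_\Sigma^{(\epsilon)})^2\to\sigma_\Sigma^2$ as $\epsilon\downarrow0$. Under join-idle-queue (JIQ) every server sends a message to the dispatcher's memory when it becomes idle; arriving jobs are sent to a uniformly chosen server among those with a message in memory, whose message is then removed, and to a uniformly chosen server among all $N$ if there is no message. The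 resource-pooled system is the single queue $q(t+1)=[q(t)+A_\Sigma(t)-\sum_nS_n(t)]^+$. Bars denote steady state. A policy is heavy-traffic delay optimal if for all such arrivals (with a bound common to all $\epsilon$) and services the system has a steady state and $\lim_{\epsilon\downarrow0}\epsilon\,\mathbb E[\sum_n\overline Q_n^{(\epsilon)}]=\lim_{\epsilon\downarrow0}\epsilon\,\mathbb E[\overline q^{(\epsilon)}]$. **Theorem.** For two homogeneous servers, JIQ is not heavy-traffic delay optimal. More precisely, let $N=2$ and $S_1(t)=S_2(t)=1$, and let $p_0>0$, $\epsilon_0>0$ and the arrivals $A_\Sigma^{(\epsilon)}$, $0<\epsilon<\epsilon_0$, satisfy $\mathbb E[A_\Sigma^{(\epsilon)}(t)]=2-\epsilon$, $\mathbb P(A_\Sigma^{(\epsilon)}(t)=0)=p_0$ for all $\epsilon$, and $(\sigma_\Sigma^{(\epsilon)})^2\to\sigma_\Sigma^2>\frac8{p_0}-4$. Then for every $\epsilon\in(0,\epsilon_0)$ both the system under JIQ and the resource-pooled system have a stationary distribution, and the stationary mean queue lengths are finite. The cross term $$\overline B^{(\epsilon)}=\mathbb E\big[\|\overline{\mathbf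 Q}^{(\epsilon)}(t+1)\|_1\,\|\overline{\mathbf U}^{(\epsilon)}(t)\|_1\big]$$ satisfies $\liminf_{\epsilon\downarrow0}\overline B^{(\epsilon)}>0$, and JIQ does not reach the resource-pooled lower bound: $$\liminf_{\epsilon\downarrow0}\epsilon\,\mathbb E\Big[\sum_n\overline Q_n^{(\epsilon)}\Big]>\lim_{\epsilon\downarrow0}\epsilon\,\mathbb E\big[\overline q^{(\epsilon)}\big]=\frac{\sigma_\Sigma^2}2 .$$ -/

import Mathlib

open Filter Topology MeasureTheory ProbabilityTheory
open scoped ENNReal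

noncomputable section

namespace LoadBalancing

/-! ### The load balancing system -/

/-- State `Z = (Q, m)` at the beginning of a time slot: the queue lengths and the set of server IDs
stored in the memory of the dispatcher. -/
abbrev State (N : ℕ) : Type := (Fin N → ℕ) × Finset (Fin N)

/-- A load balancing policy on `N` servers. `dispatch Q m` is the law of the server that receives
all jobs arriving in a slot which starts in the state `(Q, m)`. `update m a n Q'` is the memory at
the beginning of the next slot when the memory was `m`, `a` jobs arrived and were sent to server
`n`, and the queue lengths at the end of the slot are `Q'`. -/
structure Policy (N : ℕ) where
  dispatch : (Fin N → ℕ) → Finset (Fin N) → PMF (Fin N)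
  update : Finset (Fin N) → ℕ → Fin N → (Fin N → ℕ) → Finset (Fin N)

/-- Join-idle-queue. If there are pull messages in memory, the arriving jobs go to a server chosen
uniformly among those of the messages; otherwise to a server chosen uniformly among all. A message
that has been used for jobs is removed, and servers that are idle at the end of the slot have their
message in memory. -/
def jiq (N : ℕ) [NeZero N] : Policy N where
  dispatch _ m := if h : m.Nonempty then PMF.uniformOfFinset m h else PMF.uniformOfFintype (Fin N)
  update m a n Q' := (if a = 0 then m else m.erase n) ∪ Finset.univ.filter (fun i => Q' i = 0)

/-- Joint law of the services `(S₁, …, S_N)` offered in one slot: independent with `S_n ∼ ν n`. -/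
def serviceLaw {N : ℕ} (ν : Fin N → PMF ℕ) : PMF (Fin N → ℕ) :=
  (Measure.pi fun n => (ν n).toMeasure).toPMF

/-- What happens in one slot: the number `a` of exogenous arrivals, the server `n` to which all of
them are sent, and the offered services `s`. -/
abbrev Slot (N : ℕ) : Type := ℕ × Fin N × (Fin N → ℕ)

/-- Queue lengths at the end of a slot, `Q_n(t+1) = [Q_n(t) + A_n(t) - S_n(t)]⁺`
(subtraction in `ℕ` is truncated at zero). -/
def nextQueue {N : ℕ} (Q : Fin N → ℕ) (w : Slot N) : Fin N → ℕ :=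
  fun i => Q i + (if i = w.2.1 then w.1 else 0) - w.2.2 i

/-- Unused service in a slot, `U_n(t) = max (S_n(t) - Q_n(t) - A_n(t), 0)`. -/
def unused {N : ℕ} (Q : Fin N → ℕ) (w : Slot N) : Fin N → ℕ :=
  fun i => w.2.2 i - (Q i + (if i = w.2.1 then w.1 else 0))

namespace Policy

variable {N : ℕ}

/-- Law of the events of one slot that starts in the state `z`: arrivals (law `A`) and services
(law `ν n` at server `n`) are independent of each other, of the state and of the dispatching
decision. -/
def slotLaw (P : Policy N) (A : PMF ℕ) (ν : Fin N → PMF ℕ) (z : State N) : PMF (Slot N) :=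
  A.bind fun a => (P.dispatch z.1 z.2).bind fun n => (serviceLaw ν).map fun s => (a, n, s)

/-- The state at the beginning of the next slot. -/
def next (P : Policy N) (z : State N) (w : Slot N) : State N :=
  (nextQueue z.1 w, P.update z.2 w.1 w.2.1 (nextQueue z.1 w))

/-- One-step transition law of the Markov chain `Z(t) = (Q(t), m(t))`. -/
def step (P : Policy N) (A : PMF ℕ) (ν : Fin N → PMF ℕ) (z : State N) : PMF (State N) :=
  (P.slotLaw A ν z).map (P.next z)

end Policy

/-- One-step transition law of the resource-pooled system, a single queue with the arrivals
`A_Σ(t)` and the service `∑ S_n(t)`. -/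
def pooledStep {N : ℕ} (A : PMF ℕ) (ν : Fin N → PMF ℕ) (q : ℕ) : PMF ℕ :=
  A.bind fun a => (serviceLaw ν).map fun s => q + a - ∑ i, s i

/-- `π` is a stationary distribution of the Markov chain with transition law `K`. -/
def IsStationary {α : Type*} (K : α → PMF α) (π : PMF α) : Prop :=
  π.bind K = π

/-- Expectation of a `[0, ∞]`-valued function. -/
def expect {α : Type*} (p : PMF α) (f : α → ℝ≥0∞) : ℝ≥0∞ :=
  ∑' x, p x * f x

/-- `E[∑ Q_n]` when the state has law `π`. -/
def meanTotalQueue {N : ℕ} (π : PMF (State N)) : ℝ≥0∞ :=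
  expect π fun z => ∑ i, (z.1 i : ℝ≥0∞)

/-- `E[q]` when the single queue has law `ρ`. -/
def meanQueue (ρ : PMF ℕ) : ℝ≥0∞ :=
  expect ρ fun q => (q : ℝ≥0∞)

/-- The cross term `B = E[‖Q(t+1)‖₁ ‖U(t)‖₁]` when the state at time `t` has law `π`. -/
def crossTerm {N : ℕ} (P : Policy N) (A : PMF ℕ) (ν : Fin N → PMF ℕ) (π : PMF (State N)) : ℝ≥0∞ :=
  expect π fun z => expect (P.slotLaw A ν z) fun w =>
    (∑ i, (nextQueue z.1 w i : ℝ≥0∞)) * (∑ i, (unused z.1 w i : ℝ≥0∞))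

/-! ### Heavy traffic -/

/-- The law `p` is carried by `{0, …, K}`. -/
def BoundedBy (p : PMF ℕ) (K : ℕ) : Prop :=
  ∀ k, p k ≠ 0 → k ≤ K

/-- Mean of a law on `ℕ`. -/
def mean (p : PMF ℕ) : ℝ :=
  ∫ k, (k : ℝ) ∂p.toMeasure

/-- Variance of a law on `ℕ`. -/
def variance (p : PMF ℕ) : ℝ :=
  Var[fun k : ℕ => (k : ℝ); p.toMeasure]

/-- `A ε`, `0 < ε < ε₀`, is a family of laws of the number of arrivals per slot, each of bounded
support, with mean `μ - ε` (where `μ` is the total service rate) and with variances converging to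
`σ2` as `ε ↓ 0`. -/
structure IsArrivalFamily (μ ε₀ σ2 : ℝ) (A : ℝ → PMF ℕ) : Prop where
  pos : 0 < ε₀
  bounded : ∀ ε ∈ Set.Ioo 0 ε₀, ∃ K, BoundedBy (A ε) K
  mean_eq : ∀ ε ∈ Set.Ioo 0 ε₀, mean (A ε) = μ - ε
  tendsto_variance : Tendsto (fun ε => variance (A ε)) (𝓝[>] 0) (𝓝 σ2)

/-- Heavy-traffic delay optimality of a policy for the service laws `ν`: for all arrival families
(bounded by a common constant) the system has a stationary distribution, and
`lim ε E[∑ Q_n] = lim ε E[q]` as `ε ↓ 0`, where the expectations are in steady state and `q` is the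
queue of the resource-pooled system. -/
def DelayOptimalFor {N : ℕ} (P : Policy N) (ν : Fin N → PMF ℕ) : Prop :=
  ∀ (ε₀ σ2 : ℝ) (A : ℝ → PMF ℕ), IsArrivalFamily (∑ n, mean (ν n)) ε₀ σ2 A →
    (∃ K, ∀ ε ∈ Set.Ioo 0 ε₀, BoundedBy (A ε) K) →
    (∀ ε ∈ Set.Ioo 0 ε₀, ∃ π, IsStationary (P.step (A ε) ν) π) ∧
    ∀ (π : ℝ → PMF (State N)) (ρ : ℝ → PMF ℕ),
      (∀ ε ∈ Set.Ioo 0 ε₀, IsStationary (P.step (A ε) ν) (π ε)) →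
      (∀ ε ∈ Set.Ioo 0 ε₀, IsStationary (pooledStep (A ε) ν) (ρ ε)) →
      ∃ L : ℝ≥0∞,
        Tendsto (fun ε => ENNReal.ofReal ε * meanTotalQueue (π ε)) (𝓝[>] 0) (𝓝 L) ∧
        Tendsto (fun ε => ENNReal.ofReal ε * meanQueue (ρ ε)) (𝓝[>] 0) (𝓝 L)

/-- Heavy-traffic delay optimality of a policy on homogeneous servers: it holds for all service
laws of bounded support that are common to all servers. -/
def DelayOptimalHomogeneous {N : ℕ} (P : Policy N) : Prop :=
  ∀ ν : PMF ℕ, (∃ K, BoundedBy ν K) → DelayOptimalFor P fun _ => ν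

/-- The class `𝒜` of arrival families for two servers of constant service rate one: the probability
of no arrival is a constant `p₀`, and the limiting variance satisfies `σ2 > 8 / p₀ - 4`. -/
structure IsClassA (p₀ ε₀ σ2 : ℝ) (A : ℝ → PMF ℕ) : Prop extends IsArrivalFamily 2 ε₀ σ2 A where
  p₀_pos : 0 < p₀
  apply_zero : ∀ ε ∈ Set.Ioo 0 ε₀, A ε 0 = ENNReal.ofReal p₀
  lt_variance : 8 / p₀ - 4 < σ2

/-- Constant unit service at both of two servers. -/
def unitService : Fin 2 → PMF ℕ := fun _ => PMF.pure 1

end LoadBalancing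

end

/-! In steady state the memory is exactly the set of idle servers
(`mismatch_eq_empty_of_isStationary`), so only the two queue lengths matter. Let X be the mean total
queue, D its part on the event that exactly one server is idle, and m₂ = E(A-2)². Balancing the
stationary drifts of the total, of its square and of the sum of squares gives three linear equations
(`jiq_stationary_equations`). The first says that the mean unused service is ε, so idleness has
probability O(ε) for fixed p₀; up to O(ε) the other two read 2εX = m₂ + 2p₀D and εX + 2D = m₂ + 2.

The excess p₀D over the pooled value m₂/2 comes from slots without arrivals in which one server is
idle while the other has a long queue. It cannot vanish: with no idle server, uniform routing does
not pull the queues together, so their difference spreads until one of them empties. Algebraically,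
D → 0 would force εX to be close to both m₂/2 and m₂ + 2. Eliminating X gives D ≈ (m₂+4)/(2(2+p₀)) >
1/2, whence both claims on join-idle-queue (`IsClassA.jiq_bounds`).

In the pooled queue, service is unused only when the queue ends empty, so the cross term is zero and
εE[q] → σ²/2 (`meanQueue_bounds`).

The rest is Foster-Lyapunov theory: quadratic functions give existence and finite means, cubic ones
give finite second moments, without which the quadratic drifts could not be balanced. A three-point
arrival family refutes delay optimality. -/

noncomputable section

namespace LoadBalancing

/-! ### Expectations -/

section Expect

variable {α β : Type*}

theorem expect_pure (a : α) (f : α → ℝ≥0∞) : expect (PMF.pure a) f = f a := by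
  unfold expect
  rw [tsum_eq_single a]
  · simp
  · intro b hb
    simp [PMF.pure_apply, hb]

theorem expect_bind (p : PMF α) (k : α → PMF β) (f : β → ℝ≥0∞) :
    expect (p.bind k) f = expect p fun a => expect (k a) f := by
  unfold expect
  simp_rw [PMF.bind_apply, ← ENNReal.tsum_mul_right, ← ENNReal.tsum_mul_left]
  rw [ENNReal.tsum_comm]
  simp_rw [mul_assoc]

theorem expect_map (p : PMF α) (g : α → β) (f : β → ℝ≥0∞) :
    expect (p.map g) f = expect p fun a => f (g a) := by
  rw [PMF.map, expect_bind]
  simp [expect_pure]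

theorem expect_add (p : PMF α) (f g : α → ℝ≥0∞) :
    expect p (fun x => f x + g x) = expect p f + expect p g := by
  simp [expect, mul_add, ENNReal.tsum_add]

theorem expect_const_mul (p : PMF α) (c : ℝ≥0∞) (f : α → ℝ≥0∞) :
    expect p (fun x => c * f x) = c * expect p f := by
  simp [expect, ← ENNReal.tsum_mul_left, mul_left_comm]

theorem expect_const (p : PMF α) (c : ℝ≥0∞) : expect p (fun _ => c) = c := by
  simp [expect, ENNReal.tsum_mul_right, p.tsum_coe]

theorem expect_mono {p : PMF α} {f g : α → ℝ≥0∞} (h : ∀ x, p x ≠ 0 → f x ≤ g x) :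
    expect p f ≤ expect p g := by
  refine ENNReal.tsum_le_tsum fun x => ?_
  by_cases hx : p x = 0
  · simp [hx]
  · gcongr
    exact h x hx

theorem expect_congr {p : PMF α} {f g : α → ℝ≥0∞} (h : ∀ x, p x ≠ 0 → f x = g x) :
    expect p f = expect p g :=
  le_antisymm (expect_mono fun x hx => (h x hx).le) (expect_mono fun x hx => (h x hx).ge)

theorem le_expect (p : PMF α) (f : α → ℝ≥0∞) (x : α) : p x * f x ≤ expect p f :=
  ENNReal.le_tsum x

/-- Equal total masses leave no room for a strict inequality. This upgrades the subinvariance of a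
limit law to invariance. -/
theorem eq_of_le (p q : PMF α) (h : ∀ x, p x ≤ q x) : p = q := by
  by_contra hne
  obtain ⟨x, hx⟩ : ∃ x, p x ≠ q x := by
    by_contra! hall
    exact hne (PMF.ext hall)
  have := ENNReal.tsum_lt_tsum (f := p) (g := q) (by simp [p.tsum_coe]) h
    (lt_of_le_of_ne (h x) hx)
  simp [PMF.tsum_coe] at this

end Expect

/-! ### Stationary distributions -/

section Stationary

variable {α : Type*} {K : α → PMF α} {π : PMF α}

theorem IsStationary.expect_eq (h : IsStationary K π) (V : α → ℝ≥0∞) :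
    expect π (fun z => expect (K z) V) = expect π V := by
  conv_rhs => rw [← h]
  rw [expect_bind]

/-- If the mean drift of an integrable function is balanced by `g` and `h` then `g` and `h` have
the same stationary mean. -/
theorem IsStationary.expect_le_of_drift (hπ : IsStationary K π) {V g h : α → ℝ≥0∞}
    (hV : expect π V ≠ ∞)
    (hd : ∀ z, π z ≠ 0 → expect (K z) V + g z ≤ V z + h z) : expect π g ≤ expect π h := by
  have := expect_mono hd
  rw [expect_add, expect_add, hπ.expect_eq] at this
  exact (ENNReal.add_le_add_iff_left hV).1 this

theorem IsStationary.expect_eq_of_drift (hπ : IsStationary K π) {V g h : α → ℝ≥0∞}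
    (hV : expect π V ≠ ∞)
    (hd : ∀ z, π z ≠ 0 → expect (K z) V + g z = V z + h z) : expect π g = expect π h := by
  have := expect_congr hd
  rw [expect_add, expect_add, hπ.expect_eq] at this
  exact (ENNReal.add_right_inj hV).1 this

/-- Foster-Lyapunov moment bound. No integrability of `V` is assumed. -/
theorem IsStationary.expect_le_of_foster (hπ : IsStationary K π) {V f : α → ℝ≥0∞} {b : ℝ≥0∞}
    (hV : ∀ z, V z ≠ ∞)
    (hd : ∀ z, π z ≠ 0 → expect (K z) V + f z ≤ V z + b) : expect π f ≤ b := by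
  classical
  -- The truncation `min V M` is integrable, so its mean cancels. It inherits the drift bound where
  -- `V ≤ M` and cannot increase in mean elsewhere.
  have key : ∀ M : ℝ≥0∞, M ≠ ∞ → expect π (fun z => if V z ≤ M then f z else 0) ≤ b := by
    intro M hM
    have hVM : expect π (fun z => min (V z) M) ≠ ∞ :=
      ne_top_of_le_ne_top hM ((expect_mono fun z _ => min_le_right _ _).trans_eq (expect_const π M))
    rw [← expect_const π b]
    refine hπ.expect_le_of_drift hVM fun z hz => ?_
    by_cases hz' : V z ≤ M
    · simp only [hz', if_true, min_eq_left hz']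
      refine le_trans ?_ (hd z hz)
      gcongr
      exact expect_mono fun x _ => min_le_left _ _
    · simp only [hz', if_false, min_eq_right (not_le.1 hz').le, add_zero]
      refine le_trans ?_ le_self_add
      exact (expect_mono fun x _ => min_le_right _ _).trans_eq (expect_const _ M)
  unfold expect
  rw [ENNReal.tsum_eq_iSup_sum]
  refine iSup_le fun s => ?_
  -- The sum of `V` over the finite set `s` is a finite level that dominates `V` on `s`.
  refine le_trans ?_ (key (∑ z ∈ s, V z) (ENNReal.sum_ne_top.2 fun z _ => hV z))
  refine le_trans (le_of_eq ?_) (ENNReal.sum_le_tsum s)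
  refine Finset.sum_congr rfl fun z hz => ?_
  simp only [if_pos (Finset.single_le_sum (f := V) (fun _ _ => zero_le) hz)]

/-- Law of the chain with transition law `K` after `n` steps from `z`. -/
def iterLaw (K : α → PMF α) (z : α) : ℕ → PMF α
  | 0 => PMF.pure z
  | n + 1 => (iterLaw K z n).bind K

/-- Average of the laws of the first `n + 1` states of the chain. -/
def cesaro (K : α → PMF α) (z : α) (n : ℕ) (x : α) : ℝ≥0∞ :=
  ((n : ℝ≥0∞) + 1)⁻¹ * ∑ k ∈ Finset.range (n + 1), iterLaw K z k x

theorem tsum_cesaro_mul (K : α → PMF α) (z : α) (n : ℕ) (f : α → ℝ≥0∞) :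
    ∑' x, cesaro K z n x * f x =
      ((n : ℝ≥0∞) + 1)⁻¹ * ∑ k ∈ Finset.range (n + 1), expect (iterLaw K z k) f := by
  simp_rw [cesaro, mul_assoc, ENNReal.tsum_mul_left, Finset.sum_mul]
  rw [Summable.tsum_finsetSum fun _ _ => ENNReal.summable]
  rfl

theorem inv_succ_mul_succ (n : ℕ) : ((n : ℝ≥0∞) + 1)⁻¹ * ((n : ℝ≥0∞) + 1) = 1 :=
  ENNReal.inv_mul_cancel (by simp) (by finiteness)

theorem tsum_cesaro (K : α → PMF α) (z : α) (n : ℕ) : ∑' x, cesaro K z n x = 1 := by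
  have := tsum_cesaro_mul K z n fun _ => 1
  simp only [mul_one, expect_const] at this
  rw [this]
  simp [inv_succ_mul_succ]

/-- Summing the drift inequality along the chain telescopes `V`; division by the number of steps
leaves a bound uniform in `n`. -/
theorem tsum_cesaro_mul_le_of_foster {V f : α → ℝ≥0∞} {b : ℝ≥0∞}
    (hd : ∀ z, expect (K z) V + f z ≤ V z + b) (z : α) (n : ℕ) :
    ∑' x, cesaro K z n x * f x ≤ V z + b := by
  have h : ∀ n, expect (iterLaw K z n) V + ∑ k ∈ Finset.range n, expect (iterLaw K z k) f ≤
      V z + n * b := by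
    intro n
    induction n with
    | zero => simp [iterLaw, expect_pure]
    | succ n ih =>
      have h1 : expect (iterLaw K z (n + 1)) V + expect (iterLaw K z n) f ≤
          expect (iterLaw K z n) V + b := by
        rw [iterLaw, expect_bind, ← expect_add, ← expect_const (iterLaw K z n) b, ← expect_add]
        exact expect_mono fun x _ => by simpa [expect_const] using hd x
      rw [Finset.sum_range_succ]
      calc _ = expect (iterLaw K z (n + 1)) V + expect (iterLaw K z n) f +
            ∑ k ∈ Finset.range n, expect (iterLaw K z k) f := by ring
        _ ≤ expect (iterLaw K z n) V + b + ∑ k ∈ Finset.range n, expect (iterLaw K z k) f := by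
          gcongr
        _ = expect (iterLaw K z n) V + ∑ k ∈ Finset.range n, expect (iterLaw K z k) f + b := by
          ring
        _ ≤ V z + n * b + b := by gcongr
        _ = _ := by push_cast; ring
  rw [tsum_cesaro_mul]
  calc _ ≤ ((n : ℝ≥0∞) + 1)⁻¹ * (((n : ℝ≥0∞) + 1) * (V z + b)) := by
        gcongr
        refine le_add_self.trans ((h (n + 1)).trans ?_)
        push_cast
        rw [mul_add]
        gcongr
        exact le_mul_of_one_le_left' le_add_self
    _ = V z + b := by rw [← mul_assoc, inv_succ_mul_succ, one_mul]

/-- One more step shifts the window of averaging by one, which adds at most a single term of weight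
`1/(n+1)`. -/
theorem tsum_cesaro_mul_kernel_le (K : α → PMF α) (z : α) (n : ℕ) (y : α) :
    ∑' x, cesaro K z n x * K x y ≤ cesaro K z n y + ((n : ℝ≥0∞) + 1)⁻¹ := by
  rw [tsum_cesaro_mul K z n fun x => K x y]
  have h : ∀ k, expect (iterLaw K z k) (fun x => K x y) = iterLaw K z (k + 1) y := fun k => rfl
  simp_rw [h, cesaro]
  calc _ ≤ ((n : ℝ≥0∞) + 1)⁻¹ * (∑ k ∈ Finset.range (n + 1), iterLaw K z k y + 1) := by
        gcongr
        rw [Finset.sum_range_succ, Finset.sum_range_succ' _ n]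
        gcongr
        · exact le_self_add
        · exact PMF.coe_le_one _ _
    _ = _ := by ring

/-- A Markov chain with a Foster-Lyapunov function whose drift bound has finite sublevel sets has a
stationary distribution. -/
theorem exists_isStationary_of_foster {V f : α → ℝ≥0∞} {b : ℝ≥0∞} (hb : b ≠ ∞)
    (hd : ∀ z, expect (K z) V + f z ≤ V z + b) (hf : ∀ R : ℕ, {z | f z ≤ R}.Finite)
    {z₀ : α} (hz₀ : V z₀ ≠ ∞) : ∃ π, IsStationary K π := by
  classical
  -- By compactness of `[0, ∞]`, all coordinates converge at once along an ultrafilter, without a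
  -- diagonal subsequence.
  let F : Ultrafilter ℕ := hyperfilter ℕ
  have hF : (F : Filter ℕ) ≤ atTop := Nat.hyperfilter_le_atTop
  have hlim : ∀ x, ∃ l, Tendsto (fun n => cesaro K z₀ n x) F (𝓝 l) := fun x => by
    obtain ⟨l, -, hl⟩ := isCompact_univ.ultrafilter_le_nhds
      (F.map fun n => cesaro K z₀ n x) (by simp)
    exact ⟨l, hl⟩
  choose μ hμ using hlim
  have hle : ∑' x, μ x ≤ 1 := by
    rw [ENNReal.tsum_eq_iSup_sum]
    refine iSup_le fun s => ?_
    refine le_of_tendsto (tendsto_finsetSum s fun x _ => hμ x) (Eventually.of_forall fun n => ?_)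
    exact (ENNReal.sum_le_tsum s).trans (tsum_cesaro K z₀ n).le
  set C := V z₀ + b with hC
  have hCtop : C ≠ ∞ := ENNReal.add_ne_top.2 ⟨hz₀, hb⟩
  -- Tightness by Markov's inequality: outside the finite set `f ≤ R` each average has mass at most
  -- `C / R`. Letting `R` grow, no mass escapes in the limit.
  have hge' : ∀ R : ℕ, (R : ℝ≥0∞) ≤ R * ∑' x, μ x + C := by
    intro R
    set S := (hf R).toFinset with hS
    have h1 : ∀ n, (R : ℝ≥0∞) ≤ R * ∑ x ∈ S, cesaro K z₀ n x + C := by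
      intro n
      calc (R : ℝ≥0∞) = R * ∑' x, cesaro K z₀ n x := by rw [tsum_cesaro, mul_one]
        _ = ∑' x, R * cesaro K z₀ n x := by rw [ENNReal.tsum_mul_left]
        _ ≤ ∑' x, ((if x ∈ S then R * cesaro K z₀ n x else 0) + cesaro K z₀ n x * f x) := by
          refine ENNReal.tsum_le_tsum fun x => ?_
          by_cases hx : x ∈ S
          · simp [hx]
          · have : (R : ℝ≥0∞) ≤ f x := by
              simp only [hS, Set.Finite.mem_toFinset, Set.mem_ofPred_eq, not_le] at hx
              exact hx.le
            simp only [hx, if_false, zero_add]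
            rw [mul_comm]
            gcongr
        _ ≤ _ := by
          rw [ENNReal.tsum_add]
          gcongr
          · rw [tsum_eq_sum (s := S) (fun x hx => by simp [hx]), Finset.mul_sum]
            exact Finset.sum_le_sum fun x hx => by simp [hx]
          · exact tsum_cesaro_mul_le_of_foster hd z₀ n
    have h2 : (R : ℝ≥0∞) ≤ R * ∑ x ∈ S, μ x + C := by
      refine ge_of_tendsto (Tendsto.add (ENNReal.Tendsto.const_mul
        (tendsto_finsetSum S fun x _ => hμ x) (Or.inr (by finiteness))) tendsto_const_nhds)
        (Eventually.of_forall h1)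
    refine h2.trans ?_
    gcongr
    exact ENNReal.sum_le_tsum S
  have hge : 1 ≤ ∑' x, μ x := by
    by_contra! hlt
    lift C to NNReal using hCtop with c
    have hfin : ∑' x, μ x ≠ ∞ := hlt.ne_top
    lift ∑' x, μ x to NNReal using hfin with t
    have ht : t < 1 := by exact_mod_cast hlt
    have ht' : (t : ℝ) < 1 := by exact_mod_cast ht
    obtain ⟨R, hR⟩ := exists_nat_gt ((c : ℝ) / (1 - t))
    have h3 : (R : ℝ) ≤ R * t + c := by exact_mod_cast hge' R
    rw [div_lt_iff₀ (by linarith)] at hR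
    nlinarith
  let π : PMF α := ⟨μ, by
    have := ENNReal.summable.hasSum (f := μ)
    rwa [le_antisymm hle hge] at this⟩
  -- Only `π K ≤ π` has to be shown, and it survives the limit because finite partial sums suffice.
  refine ⟨π, eq_of_le _ _ fun y => ?_⟩
  rw [PMF.bind_apply]
  change ∑' x, μ x * K x y ≤ μ y
  rw [ENNReal.tsum_eq_iSup_sum]
  refine iSup_le fun s => ?_
  have hinv : Tendsto (fun n : ℕ => ((n : ℝ≥0∞) + 1)⁻¹) F (𝓝 0) := by
    refine Tendsto.mono_left ?_ hF
    have := (tendsto_add_atTop_iff_nat 1).2 ENNReal.tendsto_inv_nat_nhds_zero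
    simpa using this
  have h4 : Tendsto (fun n => cesaro K z₀ n y + ((n : ℝ≥0∞) + 1)⁻¹) F (𝓝 (μ y)) := by
    simpa using (hμ y).add hinv
  refine le_of_tendsto_of_tendsto' (tendsto_finsetSum s fun x _ => ENNReal.Tendsto.mul_const (hμ x)
    (Or.inr (PMF.apply_ne_top _ _))) h4 fun n => ?_
  exact (ENNReal.sum_le_tsum s).trans (tsum_cesaro_mul_kernel_le K z₀ n y)

end Stationary

/-! ### Moments of the arrivals -/

section Moments

variable {A : PMF ℕ} {K : ℕ}

theorem BoundedBy.apply_eq_zero (hA : BoundedBy A K) {k : ℕ} (hk : k ∉ Finset.range (K + 1)) :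
    A k = 0 := by
  by_contra h
  have := hA k h
  simp at hk
  omega

theorem BoundedBy.integrable (hA : BoundedBy A K) (g : ℕ → ℝ) : Integrable g A.toMeasure := by
  refine Integrable.of_bound (C := ∑ k ∈ Finset.range (K + 1), |g k|)
    (measurable_of_countable g).aestronglyMeasurable ?_
  have hae : ∀ᵐ k ∂A.toMeasure, k ∈ Finset.range (K + 1) := by
    rw [ae_iff, PMF.toMeasure_apply_eq_zero_iff _ (MeasurableSet.of_discrete),
      Set.disjoint_left]
    intro k hk hk'
    exact hk (hA.apply_eq_zero hk')
  filter_upwards [hae] with k hk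
  exact Finset.single_le_sum (f := fun k => |g k|) (fun _ _ => abs_nonneg _) hk

theorem BoundedBy.integral_eq (hA : BoundedBy A K) (g : ℕ → ℝ) :
    ∫ k, g k ∂A.toMeasure = ∑ k ∈ Finset.range (K + 1), (A k).toReal * g k := by
  rw [PMF.integral_eq_tsum _ _ (hA.integrable g)]
  exact tsum_eq_sum fun k hk => by simp [hA.apply_eq_zero hk]

theorem BoundedBy.sum_toReal (hA : BoundedBy A K) :
    ∑ k ∈ Finset.range (K + 1), (A k).toReal = 1 := by
  have := hA.integral_eq fun _ => 1
  simpa using this.symm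

theorem BoundedBy.expect_ofReal (hA : BoundedBy A K) {g : ℕ → ℝ} (hg : ∀ k, 0 ≤ g k) :
    expect A (fun k => ENNReal.ofReal (g k)) =
      ENNReal.ofReal (∑ k ∈ Finset.range (K + 1), (A k).toReal * g k) := by
  unfold expect
  rw [tsum_eq_sum (s := Finset.range (K + 1)) fun k hk => by simp [hA.apply_eq_zero hk],
    ENNReal.ofReal_sum_of_nonneg fun k _ => mul_nonneg ENNReal.toReal_nonneg (hg k)]
  refine Finset.sum_congr rfl fun k _ => ?_
  rw [ENNReal.ofReal_mul ENNReal.toReal_nonneg, ENNReal.ofReal_toReal (A.apply_ne_top k)]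

/-- `A` has mean `2 - ε`, `P (A = 0) = p₀`, and second and third moments about `2` equal to `m₂`
and `m₃`. -/
def HasMoments (A : PMF ℕ) (ε p₀ m₂ m₃ : ℝ) : Prop :=
  ∀ (a b c d e : ℝ) (g : ℕ → ℝ), (∀ k, 0 ≤ g k) →
    (∀ k : ℕ, g k = a + b * (k - 2) + c * (k - 2) ^ 2 + d * (k - 2) ^ 3 + if k = 0 then e else 0) →
    expect A (fun k => ENNReal.ofReal (g k)) =
      ENNReal.ofReal (a - b * ε + c * m₂ + d * m₃ + e * p₀)

theorem BoundedBy.hasMoments {ε p₀ : ℝ} (hA : BoundedBy A K) (hmean : mean A = 2 - ε)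
    (hp₀ : 0 ≤ p₀) (hzero : A 0 = ENNReal.ofReal p₀) :
    ∃ m₃, HasMoments A ε p₀ (variance A + ε ^ 2) m₃ := by
  refine ⟨∑ k ∈ Finset.range (K + 1), (A k).toReal * ((k : ℝ) - 2) ^ 3, ?_⟩
  intro a b c d e g hg hgk
  have h0 := hA.sum_toReal
  have h1 : ∑ k ∈ Finset.range (K + 1), (A k).toReal * (k : ℝ) = 2 - ε := by
    rw [← hA.integral_eq]; exact hmean
  have h2 : ∑ k ∈ Finset.range (K + 1), (A k).toReal * ((k : ℝ) - (2 - ε)) ^ 2 = variance A := by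
    rw [← hA.integral_eq fun k => ((k : ℝ) - (2 - ε)) ^ 2, LoadBalancing.variance,
      variance_eq_integral (measurable_of_countable _).aemeasurable]
    rw [← hmean]
    rfl
  have h3 : ∑ k ∈ Finset.range (K + 1), (A k).toReal * (if k = 0 then e else 0) = p₀ * e := by
    rw [Finset.sum_eq_single 0]
    · simp [hzero, hp₀]
    · intro k _ hk
      simp [hk]
    · simp
  rw [hA.expect_ofReal hg]
  congr 1
  -- The square about `2` is re-centred at the mean: `(k-2)² = (k-(2-ε))² - 2εk + 4 - (2-ε)²`.
  have h4 : ∀ k : ℕ, (A k).toReal * g k =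
      (a - 2 * b + c * (4 - (2 - ε) ^ 2)) * (A k).toReal +
      (b - 2 * c * ε) * ((A k).toReal * (k : ℝ)) +
      c * ((A k).toReal * ((k : ℝ) - (2 - ε)) ^ 2) + d * ((A k).toReal * ((k : ℝ) - 2) ^ 3) +
      (A k).toReal * (if k = 0 then e else 0) := by
    intro k
    rw [hgk]
    ring
  simp_rw [h4, Finset.sum_add_distrib, ← Finset.mul_sum]
  rw [h0, h1, h2, h3]
  ring

/-- The second moment is `E (A - 2)²`, which determines it in terms of the mean and the variance. -/
theorem IsClassA.exists_hasMoments {p₀ ε₀ σ2 : ℝ} {A : ℝ → PMF ℕ} (h : IsClassA p₀ ε₀ σ2 A) {ε : ℝ}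
    (hε : ε ∈ Set.Ioo 0 ε₀) : ∃ m₃, HasMoments (A ε) ε p₀ (variance (A ε) + ε ^ 2) m₃ := by
  obtain ⟨K, hK⟩ := h.bounded ε hε
  exact hK.hasMoments (h.mean_eq ε hε) h.p₀_pos.le (h.apply_zero ε hε)

/-- Otherwise no job ever arrives, against a mean `2 - ε ≥ 1` for some admissible `ε ≤ 1`. Needed so
that jobs arrive with positive probability and outdated messages get used. -/
theorem IsClassA.lt_one {p₀ ε₀ σ2 : ℝ} {A : ℝ → PMF ℕ} (h : IsClassA p₀ ε₀ σ2 A) : p₀ < 1 := by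
  by_contra! hp
  have hε₀ := h.pos
  set ε := min (ε₀ / 2) 1 with hεd
  have hε : ε ∈ Set.Ioo 0 ε₀ :=
    ⟨by positivity, (min_le_left _ _).trans_lt (by linarith)⟩
  have h0 : A ε 0 = 1 := by
    refine le_antisymm (PMF.coe_le_one _ _) ?_
    rw [h.apply_zero ε hε]
    simpa using hp
  have hb : BoundedBy (A ε) 0 := by
    rw [PMF.apply_eq_one_iff] at h0
    intro k hk
    have : k ∈ (A ε).support := hk
    rw [h0] at this
    simp at this
    omega
  have h1 := h.mean_eq ε hε
  rw [mean, hb.integral_eq] at h1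
  simp at h1
  have : ε ≤ 1 := min_le_right _ _
  linarith

end Moments

/-! ### Constant unit service -/

theorem serviceLaw_unitService : serviceLaw unitService = PMF.pure (fun _ => 1) := by
  refine PMF.ext fun s => ?_
  rw [serviceLaw, Measure.toPMF_apply, Measure.pi_singleton]
  simp only [PMF.toMeasure_apply_singleton _ _ (measurableSet_singleton _), unitService,
    PMF.pure_apply, Fin.prod_univ_two, funext_iff, Fin.forall_fin_two]
  split_ifs <;> simp_all

theorem expect_pooledStep (A : PMF ℕ) (q : ℕ) (V : ℕ → ℝ≥0∞) :
    expect (pooledStep A unitService q) V = expect A fun a => V (q + a - 2) := by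
  rw [pooledStep, expect_bind, serviceLaw_unitService]
  simp [expect_map, expect_pure]

theorem expect_slotLaw (P : Policy 2) (A : PMF ℕ) (z : State 2) (f : Slot 2 → ℝ≥0∞) :
    expect (P.slotLaw A unitService z) f =
      expect A fun a => expect (P.dispatch z.1 z.2) fun n => f (a, n, fun _ => 1) := by
  simp [Policy.slotLaw, expect_bind, serviceLaw_unitService, expect_map, expect_pure]

theorem expect_step (P : Policy 2) (A : PMF ℕ) (z : State 2) (V : State 2 → ℝ≥0∞) :
    expect (P.step A unitService z) V =
      expect A fun a => expect (P.dispatch z.1 z.2) fun n => V (P.next z (a, n, fun _ => 1)) := by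
  rw [Policy.step, expect_map, expect_slotLaw]

/-! ### Drift computations -/

section Drift

variable {A : PMF ℕ} {ε p₀ m₂ m₃ : ℝ}

theorem HasMoments.expect_add_ofReal (hA : HasMoments A ε p₀ m₂ m₃) (a b c d e : ℝ) {g : ℕ → ℝ}
    {y : ℝ} (hg : ∀ k, 0 ≤ g k)
    (hgk : ∀ k : ℕ,
      g k = a + b * (k - 2) + c * (k - 2) ^ 2 + d * (k - 2) ^ 3 + if k = 0 then e else 0)
    (hy : 0 ≤ y) :
    expect A (fun k => ENNReal.ofReal (g k)) + ENNReal.ofReal y =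
      ENNReal.ofReal (a - b * ε + c * m₂ + d * m₃ + e * p₀ + y) := by
  have h := hA (a + y) b c d e (fun k => g k + y) (fun k => add_nonneg (hg k) hy)
    (fun k => by rw [hgk]; ring)
  rw [← expect_const A (ENNReal.ofReal y), ← expect_add]
  calc _ = expect A (fun k => ENNReal.ofReal (g k + y)) :=
        expect_congr fun k _ => (ENNReal.ofReal_add (hg k) hy).symm
    _ = _ := by rw [h]; congr 1; ring

/-- Reduces a drift bound in `[0, ∞]` to a polynomial identity in the number of arrivals and one
real inequality. Negative drift is carried as a nonnegative term on the left. -/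
theorem HasMoments.drift_le (hA : HasMoments A ε p₀ m₂ m₃) (a b c d e : ℝ) {f : ℕ → ℝ≥0∞}
    {g : ℕ → ℝ} {y v w : ℝ} (hf : ∀ k, f k ≤ ENNReal.ofReal (g k)) (hg : ∀ k, 0 ≤ g k)
    (hgk : ∀ k : ℕ,
      g k = a + b * (k - 2) + c * (k - 2) ^ 2 + d * (k - 2) ^ 3 + if k = 0 then e else 0)
    (hy : 0 ≤ y) (h : a - b * ε + c * m₂ + d * m₃ + e * p₀ + y ≤ v + w) :
    expect A f + ENNReal.ofReal y ≤ ENNReal.ofReal v + ENNReal.ofReal w := by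
  calc _ ≤ expect A (fun k => ENNReal.ofReal (g k)) + ENNReal.ofReal y := by
        gcongr
        exact expect_mono fun k _ => hf k
    _ = _ := hA.expect_add_ofReal a b c d e hg hgk hy
    _ ≤ ENNReal.ofReal (v + w) := ENNReal.ofReal_le_ofReal h
    _ ≤ _ := ENNReal.ofReal_add_le

theorem HasMoments.drift_eq (hA : HasMoments A ε p₀ m₂ m₃) (a b c d e : ℝ)
    {g : ℕ → ℝ} {y v w : ℝ} (hg : ∀ k, 0 ≤ g k)
    (hgk : ∀ k : ℕ,
      g k = a + b * (k - 2) + c * (k - 2) ^ 2 + d * (k - 2) ^ 3 + if k = 0 then e else 0)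
    (hy : 0 ≤ y) (hv : 0 ≤ v) (hw : 0 ≤ w)
    (h : a - b * ε + c * m₂ + d * m₃ + e * p₀ + y = v + w) :
    expect A (fun k => ENNReal.ofReal (g k)) + ENNReal.ofReal y =
      ENNReal.ofReal v + ENNReal.ofReal w := by
  rw [hA.expect_add_ofReal a b c d e hg hgk hy, h, ENNReal.ofReal_add hv hw]

end Drift

/-! ### The resource-pooled system -/

section Pooled

variable {A : PMF ℕ} {ε p₀ m₂ m₃ : ℝ}

/-- The next queue length and the unused service are never both positive, so their product drops out
of the square. This is the vanishing of the pooled cross term. -/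
theorem cast_sub_two_sq (q a : ℕ) :
    ((q + a - 2 : ℕ) : ℝ) ^ 2 + ((2 - (q + a) : ℕ) : ℝ) ^ 2 = ((q : ℝ) + a - 2) ^ 2 := by
  rcases le_total 2 (q + a) with h | h
  · rw [Nat.cast_sub h, Nat.sub_eq_zero_of_le h]
    push_cast
    ring
  · rw [Nat.cast_sub h, Nat.sub_eq_zero_of_le h]
    push_cast
    ring

theorem cast_sub_two_cube_le (q a : ℕ) :
    ((q + a - 2 : ℕ) : ℝ) ^ 3 ≤ ((q : ℝ) + a - 2) ^ 3 + 8 := by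
  rcases le_total 2 (q + a) with h | h
  · rw [Nat.cast_sub h]
    push_cast
    linarith
  · rw [Nat.sub_eq_zero_of_le h]
    have h1 : (0 : ℝ) ≤ (q : ℝ) + a := by positivity
    have h2 : (q : ℝ) + a ≤ 2 := by exact_mod_cast h
    push_cast
    nlinarith [mul_nonneg h1 (sq_nonneg ((q : ℝ) + a - 3))]

theorem pooled_drift_sq (hA : HasMoments A ε p₀ m₂ m₃) (hε : 0 < ε) (hm : 0 ≤ m₂) (q : ℕ) :
    expect (pooledStep A unitService q) (fun x => ENNReal.ofReal ((x : ℝ) ^ 2)) +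
        (expect A (fun a => ENNReal.ofReal (((2 - (q + a) : ℕ) : ℝ) ^ 2)) +
          ENNReal.ofReal (2 * ε * q)) =
      ENNReal.ofReal ((q : ℝ) ^ 2) + ENNReal.ofReal m₂ := by
  rw [expect_pooledStep, ← add_assoc, ← expect_add]
  simp_rw [← ENNReal.ofReal_add (sq_nonneg _) (sq_nonneg _), cast_sub_two_sq]
  exact hA.drift_eq ((q : ℝ) ^ 2) (2 * q) 1 0 0 (fun k => sq_nonneg _) (fun k => by simp; ring)
    (by positivity) (by positivity) hm (by ring)

theorem pooled_drift_cube (hA : HasMoments A ε p₀ m₂ m₃) (hε : 0 < ε) (q : ℕ) :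
    expect (pooledStep A unitService q) (fun x => ENNReal.ofReal ((x : ℝ) ^ 3)) +
        ENNReal.ofReal (ε * (q : ℝ) ^ 2) ≤
      ENNReal.ofReal ((q : ℝ) ^ 3) + ENNReal.ofReal (9 * m₂ ^ 2 / (8 * ε) + |m₃| + 8) := by
  rw [expect_pooledStep]
  refine hA.drift_le ((q : ℝ) ^ 3 + 8) (3 * q ^ 2) (3 * q) 1 0
    (g := fun k => ((q : ℝ) + k - 2) ^ 3 + 8)
    (fun k => ENNReal.ofReal_le_ofReal (cast_sub_two_cube_le q k))
    (fun k => le_trans (by positivity) (cast_sub_two_cube_le q k))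
    (fun k => by simp; ring) (by positivity) ?_
  -- The cubic drift contains `-3εq²`; two thirds of it absorb the term linear in `q` by completing
  -- the square, and `-εq²` remains.
  have h1 : 3 * q * m₂ ≤ 2 * ε * (q : ℝ) ^ 2 + 9 * m₂ ^ 2 / (8 * ε) := by
    have : 2 * ε * (q : ℝ) ^ 2 + 9 * m₂ ^ 2 / (8 * ε) - 3 * q * m₂ =
        (4 * ε * q - 3 * m₂) ^ 2 / (8 * ε) := by field_simp; ring
    have h2 : 0 ≤ (4 * ε * q - 3 * m₂) ^ 2 / (8 * ε) := by positivity
    linarith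
  have := le_abs_self m₃
  linarith

theorem expect_ne_top_of_ofReal_mul {α : Type*} {p : PMF α} {f : α → ℝ} {c : ℝ} (hc : 0 < c)
    {b : ℝ≥0∞} (hb : b ≠ ∞) (h : expect p (fun x => ENNReal.ofReal (c * f x)) ≤ b) :
    expect p (fun x => ENNReal.ofReal (f x)) ≠ ∞ := by
  simp_rw [ENNReal.ofReal_mul hc.le, expect_const_mul] at h
  intro htop
  rw [htop, ENNReal.mul_top (by simpa using hc)] at h
  exact hb (top_le_iff.1 h)

theorem exists_isStationary_pooledStep (hA : HasMoments A ε p₀ m₂ m₃) (hε : 0 < ε) (hm : 0 ≤ m₂) :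
    ∃ ρ, IsStationary (pooledStep A unitService) ρ := by
  refine exists_isStationary_of_foster (V := fun x => ENNReal.ofReal ((x : ℝ) ^ 2))
    (f := fun x => ENNReal.ofReal (2 * ε * x)) (b := ENNReal.ofReal m₂) (by finiteness) (fun q => ?_)
    (fun R => ?_) (z₀ := 0) (by finiteness)
  · rw [← pooled_drift_sq hA hε hm q]
    gcongr
    exact le_add_self
  · refine (Set.finite_Iic ⌈(R : ℝ) / (2 * ε)⌉₊).subset fun q hq => ?_
    simp only [Set.mem_ofPred_eq] at hq
    rw [← ENNReal.ofReal_natCast R, ENNReal.ofReal_le_ofReal_iff (by positivity)] at hq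
    have : (q : ℝ) ≤ (R : ℝ) / (2 * ε) := by
      rw [le_div_iff₀ (by positivity)]
      linarith
    exact_mod_cast this.trans (Nat.le_ceil _)

variable {ρ : PMF ℕ}

theorem meanQueue_eq (ρ : PMF ℕ) : meanQueue ρ = expect ρ fun q => ENNReal.ofReal q := by
  simp [meanQueue]

theorem meanQueue_ne_top (hA : HasMoments A ε p₀ m₂ m₃) (hε : 0 < ε) (hm : 0 ≤ m₂)
    (hρ : IsStationary (pooledStep A unitService) ρ) : meanQueue ρ ≠ ∞ := by
  rw [meanQueue_eq]
  refine expect_ne_top_of_ofReal_mul (c := 2 * ε) (by positivity) (b := ENNReal.ofReal m₂)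
    (by finiteness) (hρ.expect_le_of_foster (V := fun x => ENNReal.ofReal ((x : ℝ) ^ 2))
      (by finiteness) fun q _ => ?_)
  rw [← pooled_drift_sq hA hε hm q]
  gcongr
  exact le_add_self

theorem secondMoment_pooled_ne_top (hA : HasMoments A ε p₀ m₂ m₃) (hε : 0 < ε)
    (hρ : IsStationary (pooledStep A unitService) ρ) :
    expect ρ (fun q => ENNReal.ofReal ((q : ℝ) ^ 2)) ≠ ∞ :=
  expect_ne_top_of_ofReal_mul hε (by finiteness)
    (hρ.expect_le_of_foster (V := fun x => ENNReal.ofReal ((x : ℝ) ^ 3))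
      (by finiteness) fun q _ => pooled_drift_cube hA hε q)

/-- In steady state the mean unused service of the pooled system is the slack `ε`. -/
theorem expect_unused_pooled (hA : HasMoments A ε p₀ m₂ m₃) (hε : 0 < ε) (hε2 : ε ≤ 2)
    (hm : 0 ≤ m₂) (hρ : IsStationary (pooledStep A unitService) ρ) :
    expect ρ (fun q => expect A fun a => ((2 - (q + a) : ℕ) : ℝ≥0∞)) = ENNReal.ofReal ε := by
  have harr : expect A (fun a => (a : ℝ≥0∞)) = ENNReal.ofReal (2 - ε) := by
    have := hA 2 1 0 0 0 (fun k => (k : ℝ)) (fun k => by positivity) (fun k => by simp)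
    simpa using this
  have h := hρ.expect_eq_of_drift (V := fun q => (q : ℝ≥0∞)) (g := fun _ => 2)
    (h := fun q => ENNReal.ofReal (2 - ε) + expect A fun a => ((2 - (q + a) : ℕ) : ℝ≥0∞))
    (meanQueue_ne_top hA hε hm hρ) fun q _ => by
      rw [expect_pooledStep, ← harr, ← expect_add, ← expect_const A 2, ← expect_const A (q : ℝ≥0∞),
        ← expect_add, ← expect_add]
      refine expect_congr fun a _ => ?_
      rw [← add_assoc]
      norm_cast
      omega
  rw [expect_add, expect_const, expect_const] at h
  have h2 : (2 : ℝ≥0∞) = ENNReal.ofReal (2 - ε) + ENNReal.ofReal ε := by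
    rw [← ENNReal.ofReal_add (by linarith) hε.le]
    norm_num
  rw [h2] at h
  exact ((ENNReal.add_right_inj ENNReal.ofReal_ne_top).1 h).symm

/-- Balancing the quadratic drift gives `2ε E q + E U² = m₂`, and `U ≤ 2` with `E U = ε` gives `E U²
≤ 2ε`. -/
theorem meanQueue_bounds (hA : HasMoments A ε p₀ m₂ m₃) (hε : 0 < ε) (hε2 : ε ≤ 2)
    (hm : 0 ≤ m₂) (hρ : IsStationary (pooledStep A unitService) ρ) :
    ENNReal.ofReal (m₂ / 2 - ε) ≤ ENNReal.ofReal ε * meanQueue ρ ∧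
      ENNReal.ofReal ε * meanQueue ρ ≤ ENNReal.ofReal (m₂ / 2) := by
  have h := hρ.expect_eq_of_drift (secondMoment_pooled_ne_top hA hε hρ)
    fun q _ => pooled_drift_sq hA hε hm q
  rw [expect_add, expect_const] at h
  have hu : expect ρ (fun q => expect A fun a => ENNReal.ofReal (((2 - (q + a) : ℕ) : ℝ) ^ 2)) ≤
      2 * ENNReal.ofReal ε := by
    rw [← expect_unused_pooled hA hε hε2 hm hρ, ← expect_const_mul]
    refine expect_mono fun q _ => ?_
    rw [← expect_const_mul]
    refine expect_mono fun a _ => ?_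
    rw [← Nat.cast_pow, ENNReal.ofReal_natCast]
    norm_cast
    have : 2 - (q + a) ≤ 2 := by omega
    nlinarith
  have hq : expect ρ (fun q : ℕ => ENNReal.ofReal (2 * ε * q)) =
      2 * (ENNReal.ofReal ε * meanQueue ρ) := by
    rw [meanQueue_eq, ← expect_const_mul, ← expect_const_mul]
    refine expect_congr fun q _ => ?_
    rw [mul_assoc, ENNReal.ofReal_mul (by norm_num), ENNReal.ofReal_mul hε.le]
    norm_num
  rw [hq] at h
  have hfin := meanQueue_ne_top hA hε hm hρ
  set x := ENNReal.ofReal ε * meanQueue ρ with hx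
  have hxfin : x ≠ ∞ := ENNReal.mul_ne_top (by finiteness) hfin
  have h1 : 2 * x ≤ ENNReal.ofReal m₂ := h ▸ le_add_self
  have h2 : ENNReal.ofReal m₂ ≤ 2 * ENNReal.ofReal ε + 2 * x := by
    rw [← h]
    gcongr
  obtain ⟨r, hr0, hr⟩ : ∃ r : ℝ, 0 ≤ r ∧ x = ENNReal.ofReal r :=
    ⟨x.toReal, ENNReal.toReal_nonneg, (ENNReal.ofReal_toReal hxfin).symm⟩
  have h20 : (2 : ℝ≥0∞) = ENNReal.ofReal 2 := by norm_num
  rw [hr, h20, ← ENNReal.ofReal_mul (by norm_num)] at h1 h2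
  rw [← ENNReal.ofReal_mul (by norm_num), ← ENNReal.ofReal_add (by positivity) (by positivity),
    ENNReal.ofReal_le_ofReal_iff (by positivity)] at h2
  rw [ENNReal.ofReal_le_ofReal_iff hm] at h1
  rw [hr]
  exact ⟨ENNReal.ofReal_le_ofReal (by linarith), ENNReal.ofReal_le_ofReal (by linarith)⟩

end Pooled

/-! ### Join-idle-queue: the memory -/

section Memory

/-- Servers whose message status disagrees with their being idle. -/
def mismatch (z : State 2) : Finset (Fin 2) :=
  symmDiff z.2 (Finset.univ.filter fun i => z.1 i = 0)

theorem eq_of_mismatch_eq_empty {z : State 2} (hz : mismatch z = ∅) :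
    z.2 = Finset.univ.filter fun i => z.1 i = 0 := by
  rw [mismatch, ← Finset.bot_eq_empty, symmDiff_eq_bot] at hz
  exact hz

theorem mem_mismatch {z : State 2} {i : Fin 2} :
    i ∈ mismatch z ↔ (i ∈ z.2 ∧ z.1 i ≠ 0) ∨ (z.1 i = 0 ∧ i ∉ z.2) := by
  simp [mismatch, Finset.mem_symmDiff]

/-- A server idle at the end of a slot always has its message in memory. So a mismatch can only be
an old message of a busy server that was not used in the slot. -/
theorem mem_mismatch_next {z : State 2} {a : ℕ} {n i : Fin 2}
    (h : i ∈ mismatch ((jiq 2).next z (a, n, fun _ => 1))) :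
    i ∈ mismatch z ∧ i ∈ z.2 ∧ (a ≠ 0 → i ≠ n) := by
  rw [mem_mismatch] at h
  simp only [Policy.next, jiq, nextQueue, Finset.mem_union, Finset.mem_filter, Finset.mem_univ,
    true_and] at h
  rw [mem_mismatch]
  by_cases ha : a = 0
  · subst ha
    simp at h ⊢
    rcases h with h | h
    · refine ⟨Or.inl ⟨?_, ?_⟩, ?_⟩ <;> first | omega | tauto
    · tauto
  · by_cases hi : i = n
    · subst hi
      simp [ha] at h
    · simp [ha, hi] at h ⊢
      rcases h with h | h
      · refine ⟨Or.inl ⟨?_, ?_⟩, ?_⟩ <;> first | omega | tauto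
      · tauto

theorem mismatch_next_eq_empty {z : State 2} (hz : mismatch z = ∅) (a : ℕ) (n : Fin 2) :
    mismatch ((jiq 2).next z (a, n, fun _ => 1)) = ∅ := by
  refine Finset.eq_empty_of_forall_notMem fun i hi => ?_
  have := (mem_mismatch_next hi).1
  simp [hz] at this

theorem expect_uniform_fin_two (f : Fin 2 → ℝ≥0∞) :
    expect (PMF.uniformOfFintype (Fin 2)) f = 2⁻¹ * (f 0 + f 1) := by
  simp [expect, tsum_fintype, mul_add]

theorem expect_jiq_dispatch_of_nonempty {Q : Fin 2 → ℕ} {m : Finset (Fin 2)} (hm : m.Nonempty)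
    (f : Fin 2 → ℝ≥0∞) :
    expect ((jiq 2).dispatch Q m) f = (m.card : ℝ≥0∞)⁻¹ * ∑ i ∈ m, f i := by
  simp only [jiq, dif_pos hm, expect, PMF.uniformOfFinset_apply, ite_mul, zero_mul]
  rw [tsum_fintype, Finset.mul_sum, Finset.sum_ite_mem, Finset.univ_inter]

theorem expect_jiq_dispatch_empty {Q : Fin 2 → ℕ} (f : Fin 2 → ℝ≥0∞) :
    expect ((jiq 2).dispatch Q ∅) f = 2⁻¹ * (f 0 + f 1) := by
  rw [← expect_uniform_fin_two]
  simp [jiq]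

theorem card_mismatch_next_le (z : State 2) (a : ℕ) (n : Fin 2) :
    (mismatch ((jiq 2).next z (a, n, fun _ => 1))).card ≤ (mismatch z).card :=
  Finset.card_le_card fun _ hi => (mem_mismatch_next hi).1

theorem card_mismatch_next_add_one_le {z : State 2} {a : ℕ} {n i : Fin 2} (hi : i ∈ mismatch z)
    (h : i ∉ z.2 ∨ (a ≠ 0 ∧ n = i)) :
    (mismatch ((jiq 2).next z (a, n, fun _ => 1))).card + 1 ≤ (mismatch z).card := by
  refine Finset.card_lt_card ((Finset.ssubset_iff_of_subset fun _ hj => (mem_mismatch_next hj).1).2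
    ⟨i, hi, fun hi' => ?_⟩)
  obtain ⟨-, h1, h2⟩ := mem_mismatch_next hi'
  rcases h with h | ⟨h, rfl⟩
  · exact h h1
  · exact h2 h rfl

/-- In steady state the memory is the set of idle servers. -/
theorem mismatch_eq_empty_of_isStationary {A : PMF ℕ} {a₀ : ℕ} (ha₀ : a₀ ≠ 0) (hA : A a₀ ≠ 0)
    {π : PMF (State 2)} (hπ : IsStationary ((jiq 2).step A unitService) π) {z : State 2}
    (hz : π z ≠ 0) : mismatch z = ∅ := by
  classical
  set c : ℝ≥0∞ := A a₀ * 2⁻¹ with hc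
  have hc1 : c ≤ 1 := by
    calc c ≤ 1 * 1 := by
          rw [hc]
          gcongr
          · exact PMF.coe_le_one _ _
          · simp
      _ = 1 := by simp
  have hc0 : c ≠ 0 := by simp [hc, hA]
  -- The number of mismatches never grows, and from a mismatched state it falls in mean by at least
  -- `c`; with `b = 0` such states have stationary probability zero.
  have key := hπ.expect_le_of_foster (V := fun z => ((mismatch z).card : ℝ≥0∞))
    (f := fun z => if mismatch z = ∅ then 0 else c) (b := 0) (by finiteness) fun z _ => by
      rw [expect_step, add_zero]
      by_cases hz : mismatch z = ∅
      · simp [hz, mismatch_next_eq_empty, expect_const]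
      rw [if_neg hz]
      obtain ⟨i, hi⟩ := Finset.nonempty_iff_ne_empty.2 hz
      by_cases him : i ∈ z.2
      -- There are at most two messages, so a given one is picked with probability at least one
      -- half.
      · have hdisp : 2⁻¹ ≤ expect ((jiq 2).dispatch z.1 z.2) fun n => if n = i then 1 else 0 := by
          rw [expect_jiq_dispatch_of_nonempty ⟨i, him⟩, Finset.sum_ite_eq_of_mem' _ _ _ him, mul_one]
          gcongr
          exact_mod_cast (Finset.card_le_univ z.2)
        have hslot : c ≤ expect A fun a => expect ((jiq 2).dispatch z.1 z.2) fun n =>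
            if a ≠ 0 ∧ n = i then 1 else 0 := by
          refine le_trans ?_ (le_expect A _ a₀)
          rw [hc]
          gcongr
          simpa [ha₀] using hdisp
        refine (add_le_add_right hslot _).trans ?_
        rw [← expect_add, ← expect_const A ((mismatch z).card : ℝ≥0∞)]
        refine expect_mono fun a _ => ?_
        rw [← expect_add, ← expect_const ((jiq 2).dispatch z.1 z.2) ((mismatch z).card : ℝ≥0∞)]
        refine expect_mono fun n _ => ?_
        by_cases h : a ≠ 0 ∧ n = i
        · rw [if_pos h]
          exact_mod_cast card_mismatch_next_add_one_le hi (Or.inr h)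
        · rw [if_neg h, add_zero]
          exact_mod_cast card_mismatch_next_le z a n
      · refine (add_le_add_right hc1 _).trans ?_
        rw [← expect_const A (1 : ℝ≥0∞), ← expect_add,
          ← expect_const A ((mismatch z).card : ℝ≥0∞)]
        refine expect_mono fun a _ => ?_
        rw [← expect_const ((jiq 2).dispatch z.1 z.2) (1 : ℝ≥0∞), ← expect_add,
          ← expect_const ((jiq 2).dispatch z.1 z.2) ((mismatch z).card : ℝ≥0∞)]
        refine expect_mono fun n _ => ?_
        exact_mod_cast card_mismatch_next_add_one_le hi (Or.inl him)
  by_contra hne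
  have := (le_expect π _ z).trans key
  simp [hne, hz, hc0] at this

end Memory

/-! ### Join-idle-queue: drifts -/

section JIQDrift

/-- Mean of `ψ` at the queue lengths after a slot with `a` arrivals that starts with queue lengths
`q₀` and `q₁`, when the memory is the set of idle servers. -/
def slotMean (ψ : ℕ → ℕ → ℝ) (q₀ q₁ a : ℕ) : ℝ :=
  if q₀ = 0 ∧ q₁ ≠ 0 then ψ (a - 1) (q₁ - 1)
  else if q₀ ≠ 0 ∧ q₁ = 0 then ψ (q₀ - 1) (a - 1)
  else (ψ (q₀ + a - 1) (q₁ - 1) + ψ (q₀ - 1) (q₁ + a - 1)) / 2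

theorem slotMean_nonneg {ψ : ℕ → ℕ → ℝ} (hψ : ∀ x y, 0 ≤ ψ x y) (q₀ q₁ a : ℕ) :
    0 ≤ slotMean ψ q₀ q₁ a := by
  unfold slotMean
  split_ifs
  · exact hψ _ _
  · exact hψ _ _
  · have := hψ (q₀ + a - 1) (q₁ - 1)
    have := hψ (q₀ - 1) (q₁ + a - 1)
    positivity

theorem half_mul_ofReal_add {x y : ℝ} (hx : 0 ≤ x) (hy : 0 ≤ y) :
    2⁻¹ * (ENNReal.ofReal x + ENNReal.ofReal y) = ENNReal.ofReal ((x + y) / 2) := by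
  rw [← ENNReal.ofReal_add hx hy, div_eq_inv_mul, ENNReal.ofReal_mul (by norm_num),
    ENNReal.ofReal_inv_of_pos (by norm_num)]
  norm_num

/-- With memory equal to the idle set, routing is forced when exactly one server is idle. With two
messages or none it is uniform on both servers, which is why `slotMean` merges these cases. -/
theorem expect_jiq_step {A : PMF ℕ} {z : State 2} (hz : mismatch z = ∅) {ψ : ℕ → ℕ → ℝ}
    (hψ : ∀ x y, 0 ≤ ψ x y) :
    expect ((jiq 2).step A unitService z) (fun z' => ENNReal.ofReal (ψ (z'.1 0) (z'.1 1))) =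
      expect A fun a => ENNReal.ofReal (slotMean ψ (z.1 0) (z.1 1) a) := by
  rw [expect_step]
  refine expect_congr fun a _ => ?_
  have hm := eq_of_mismatch_eq_empty hz
  simp only [Policy.next, nextQueue]
  by_cases h0 : z.1 0 = 0 <;> by_cases h1 : z.1 1 = 0
  · have hm' : z.2 = {0, 1} := by rw [hm]; ext i; fin_cases i <;> simp [h0, h1]
    rw [hm', expect_jiq_dispatch_of_nonempty (by simp)]
    simp [slotMean, h0, h1, half_mul_ofReal_add, hψ]
  · have hm' : z.2 = {0} := by rw [hm]; ext i; fin_cases i <;> simp [h0, h1]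
    rw [hm', expect_jiq_dispatch_of_nonempty (by simp)]
    simp [slotMean, h0, h1]
  · have hm' : z.2 = {1} := by rw [hm]; ext i; fin_cases i <;> simp [h0, h1]
    rw [hm', expect_jiq_dispatch_of_nonempty (by simp)]
    simp [slotMean, h0, h1]
  · have hm' : z.2 = ∅ := by rw [hm]; ext i; fin_cases i <;> simp [h0, h1]
    rw [hm', expect_jiq_dispatch_empty]
    simp [slotMean, h0, h1, half_mul_ofReal_add, hψ]

/-- Indicator of exactly one of the two queues being empty. -/
def oneIdle (q₀ q₁ : ℕ) : ℝ := if (q₀ = 0 ∧ q₁ ≠ 0) ∨ (q₀ ≠ 0 ∧ q₁ = 0) then 1 else 0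

/-- Indicator of both queues being empty. -/
def bothIdle (q₀ q₁ : ℕ) : ℝ := if q₀ = 0 ∧ q₁ = 0 then 1 else 0

theorem oneIdle_nonneg (q₀ q₁ : ℕ) : 0 ≤ oneIdle q₀ q₁ := by unfold oneIdle; split_ifs <;> norm_num

theorem bothIdle_nonneg (q₀ q₁ : ℕ) : 0 ≤ bothIdle q₀ q₁ := by
  unfold bothIdle; split_ifs <;> norm_num

variable {A : PMF ℕ} {ε p₀ m₂ m₃ : ℝ}

/-- One idle server wastes a unit only if nothing arrives; two idle servers waste one unit always
and a second one if nothing arrives. -/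
theorem jiq_drift_total (hA : HasMoments A ε p₀ m₂ m₃) (hε : 0 < ε) (hp : 0 < p₀) (q₀ q₁ : ℕ) :
    expect A (fun a => ENNReal.ofReal (slotMean (fun x y => (x : ℝ) + y) q₀ q₁ a)) +
        ENNReal.ofReal ε =
      ENNReal.ofReal ((q₀ : ℝ) + q₁) +
        ENNReal.ofReal (p₀ * oneIdle q₀ q₁ + (1 + p₀) * bothIdle q₀ q₁) := by
  have ho := oneIdle_nonneg q₀ q₁
  have hb := bothIdle_nonneg q₀ q₁
  have hnn := slotMean_nonneg (ψ := fun x y => (x : ℝ) + y) (fun x y => by positivity) q₀ q₁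
  refine hA.drift_eq (q₀ + q₁ + bothIdle q₀ q₁) 1 0 0 (oneIdle q₀ q₁ + bothIdle q₀ q₁) hnn
    (fun k => ?_) hε.le (by positivity) (by positivity) (by ring)
  rcases q₀ with _ | q₀ <;> rcases q₁ with _ | q₁ <;> rcases k with _ | k <;>
    simp [slotMean, oneIdle, bothIdle, add_right_comm _ 1 _, ← add_assoc] <;> ring

/-- With one idle server and no arrival, a total `q` becomes `q - 1` instead of `q - 2`, so the
square gains `2q - 3`. This is the source of the excess over the pooled queue. -/
theorem jiq_drift_total_sq (hA : HasMoments A ε p₀ m₂ m₃) (hε : 0 < ε) (hp : 0 < p₀) (hm : 0 ≤ m₂)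
    (q₀ q₁ : ℕ) :
    expect A (fun a => ENNReal.ofReal (slotMean (fun x y => ((x : ℝ) + y) ^ 2) q₀ q₁ a)) +
        ENNReal.ofReal (2 * ε * (q₀ + q₁) + 3 * p₀ * oneIdle q₀ q₁ +
          (p₀ + 2 * ε) * bothIdle q₀ q₁) =
      ENNReal.ofReal (((q₀ : ℝ) + q₁) ^ 2) +
        ENNReal.ofReal (m₂ + 2 * p₀ * ((q₀ + q₁) * oneIdle q₀ q₁) + bothIdle q₀ q₁) := by
  have ho := oneIdle_nonneg q₀ q₁
  have hb := bothIdle_nonneg q₀ q₁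
  have hnn := slotMean_nonneg (ψ := fun x y => ((x : ℝ) + y) ^ 2) (fun x y => by positivity) q₀ q₁
  refine hA.drift_eq ((q₀ + q₁) ^ 2 + bothIdle q₀ q₁) (2 * (q₀ + q₁) + 2 * bothIdle q₀ q₁) 1 0
    ((2 * (q₀ + q₁) - 3) * oneIdle q₀ q₁ - bothIdle q₀ q₁) hnn
    (fun k => ?_) (by positivity) (by positivity) (by positivity) (by ring)
  rcases q₀ with _ | q₀ <;> rcases q₁ with _ | q₁ <;> rcases k with _ | k <;>
    simp [slotMean, oneIdle, bothIdle, add_right_comm _ 1 _, ← add_assoc] <;> ring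

/-- Uniform routing couples the arrivals to the average of the two queues, routing to an idle server
to the empty one. This difference yields the second relation between the mean total and its one-idle
part. -/
theorem jiq_drift_sum_sq (hA : HasMoments A ε p₀ m₂ m₃) (hε : 0 < ε) (hp : 0 < p₀) (hm : 0 ≤ m₂)
    (hε2 : ε ≤ 2) (q₀ q₁ : ℕ) :
    expect A (fun a => ENNReal.ofReal (slotMean (fun x y => (x : ℝ) ^ 2 + (y : ℝ) ^ 2) q₀ q₁ a)) +
        ENNReal.ofReal (2 * ε + ε * (q₀ + q₁) + (2 - ε) * ((q₀ + q₁) * oneIdle q₀ q₁) +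
          p₀ * oneIdle q₀ q₁ + (1 + p₀) * bothIdle q₀ q₁) =
      ENNReal.ofReal ((q₀ : ℝ) ^ 2 + (q₁ : ℝ) ^ 2) + ENNReal.ofReal (m₂ + 2) := by
  have ho := oneIdle_nonneg q₀ q₁
  have hb := bothIdle_nonneg q₀ q₁
  have hε2' : 0 ≤ 2 - ε := by linarith
  have hnn := slotMean_nonneg (ψ := fun x y => (x : ℝ) ^ 2 + (y : ℝ) ^ 2)
    (fun x y => by positivity) q₀ q₁
  refine hA.drift_eq (q₀ ^ 2 + q₁ ^ 2 + 2 - 2 * ((q₀ + q₁) * oneIdle q₀ q₁) - bothIdle q₀ q₁)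
    (2 + (q₀ + q₁) - (q₀ + q₁) * oneIdle q₀ q₁) 1 0 (-oneIdle q₀ q₁ - bothIdle q₀ q₁) hnn
    (fun k => ?_) (by positivity) (by positivity)
    (add_nonneg hm zero_le_two) (by ring)
  rcases q₀ with _ | q₀ <;> rcases q₁ with _ | q₁ <;> rcases k with _ | k <;>
    simp [slotMean, oneIdle, bothIdle, add_right_comm _ 1 _, ← add_assoc] <;> ring

theorem three_halves_mul_le (hε : 0 < ε) (x w : ℝ) :
    3 / 2 * x * w ≤ ε / 2 * x ^ 2 + 9 * w ^ 2 / (8 * ε) := by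
  have h1 : ε / 2 * x ^ 2 + 9 * w ^ 2 / (8 * ε) - 3 / 2 * x * w =
      (2 * ε * x - 3 * w) ^ 2 / (8 * ε) := by field_simp; ring
  have h2 : 0 ≤ (2 * ε * x - 3 * w) ^ 2 / (8 * ε) := by positivity
  linarith

/-- Serves only to make second moments finite, so a crude constant is enough. With no idle server, a
third of the `-(3/2)ε x²` of each queue absorbs the lower-order terms. -/
theorem jiq_drift_sum_cube (hA : HasMoments A ε p₀ m₂ m₃) (hε : 0 < ε) (hp : 0 < p₀) (hm : 0 ≤ m₂)
    (hε2 : ε ≤ 2) (q₀ q₁ : ℕ) :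
    expect A (fun a => ENNReal.ofReal (slotMean (fun x y => (x : ℝ) ^ 3 + (y : ℝ) ^ 3) q₀ q₁ a)) +
        ENNReal.ofReal (ε * ((q₀ : ℝ) ^ 2 + (q₁ : ℝ) ^ 2)) ≤
      ENNReal.ofReal ((q₀ : ℝ) ^ 3 + (q₁ : ℝ) ^ 3) +
        ENNReal.ofReal (9 * (m₂ - 2 * ε + 2) ^ 2 / (4 * ε) + |m₃| + 3 * m₂ + p₀ + 10) := by
  have hnn := slotMean_nonneg (ψ := fun x y => (x : ℝ) ^ 3 + (y : ℝ) ^ 3)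
    (fun x y => by positivity) q₀ q₁
  have hm₃ := le_abs_self m₃
  have hm₂ : 0 ≤ 3 * m₂ := mul_nonneg zero_le_three hm
  have hw : 0 ≤ 9 * (m₂ - 2 * ε + 2) ^ 2 / (4 * ε) := by positivity
  have hone : ∀ x : ℝ, 0 ≤ x → x ^ 3 - (x + 1) ^ 3 + ε * (x + 1) ^ 2 ≤ 5 := fun x hx => by
    have : ε * (x + 1) ^ 2 ≤ 2 * (x + 1) ^ 2 := by gcongr
    nlinarith [sq_nonneg (x - 1)]
  rcases q₀ with _ | q₀ <;> rcases q₁ with _ | q₁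
  · refine hA.drift_le 1 3 3 1 1 (fun k => le_rfl) hnn (fun k => ?_) (by positivity) ?_
    · rcases k with _ | k <;> simp [slotMean] <;> ring
    · simp
      linarith
  · refine hA.drift_le (1 + (q₁ : ℝ) ^ 3) 3 3 1 1 (fun k => le_rfl) hnn (fun k => ?_)
      (by positivity) ?_
    · rcases k with _ | k <;> simp [slotMean] <;> ring
    · have := hone q₁ (by positivity)
      push_cast
      linarith
  · refine hA.drift_le (1 + (q₀ : ℝ) ^ 3) 3 3 1 1 (fun k => le_rfl) hnn (fun k => ?_)
      (by positivity) ?_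
    · rcases k with _ | k <;> simp [slotMean] <;> ring
    · have := hone q₀ (by positivity)
      push_cast
      linarith
  · refine hA.drift_le (((q₀ : ℝ) + 1) ^ 3 + ((q₁ : ℝ) + 1) ^ 3 + 3 * ((q₀ + 1) + (q₁ + 1)))
      (3 / 2 * (((q₀ : ℝ) + 1) ^ 2 + ((q₁ : ℝ) + 1) ^ 2) + 3 * ((q₀ + 1) + (q₁ + 1)) + 3)
      (3 / 2 * ((q₀ + 1) + (q₁ + 1)) + 3) 1 0 (fun k => le_rfl) hnn (fun k => ?_)
      (by positivity) ?_
    · rcases k with _ | k <;> simp [slotMean, add_right_comm _ 1 _, ← add_assoc] <;> ring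
    · have h0 := three_halves_mul_le hε (q₀ + 1) (m₂ - 2 * ε + 2)
      have h1 := three_halves_mul_le hε (q₁ + 1) (m₂ - 2 * ε + 2)
      have h2 : 9 * (m₂ - 2 * ε + 2) ^ 2 / (4 * ε) =
        2 * (9 * (m₂ - 2 * ε + 2) ^ 2 / (8 * ε)) := by ring
      rw [h2]
      push_cast
      linarith

end JIQDrift

/-! ### Join-idle-queue: steady state -/

section JIQStationary

variable {A : PMF ℕ} {ε p₀ m₂ m₃ : ℝ}

theorem exists_isStationary_jiq (hA : HasMoments A ε p₀ m₂ m₃) (hε : 0 < ε) (hε2 : ε ≤ 2)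
    (hp : 0 < p₀) (hm : 0 ≤ m₂) : ∃ π, IsStationary ((jiq 2).step A unitService) π := by
  classical
  have hε2' : 0 ≤ 2 - ε := by linarith
  -- The value `∞` makes the drift condition void off the states with correct memory; these are
  -- closed under the dynamics.
  refine exists_isStationary_of_foster
    (V := fun z => if mismatch z = ∅ then ENNReal.ofReal ((z.1 0 : ℝ) ^ 2 + (z.1 1 : ℝ) ^ 2) else ∞)
    (f := fun z => ENNReal.ofReal (ε * (z.1 0 + z.1 1))) (b := ENNReal.ofReal (m₂ + 2))
    (by finiteness) (fun z => ?_) (fun R => ?_) (z₀ := (fun _ => 0, Finset.univ)) ?_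
  · by_cases hz : mismatch z = ∅
    · rw [if_pos hz]
      have h1 : expect ((jiq 2).step A unitService z) (fun z => if mismatch z = ∅ then
            ENNReal.ofReal ((z.1 0 : ℝ) ^ 2 + (z.1 1 : ℝ) ^ 2) else ∞) =
          expect A fun a => ENNReal.ofReal
            (slotMean (fun x y => (x : ℝ) ^ 2 + (y : ℝ) ^ 2) (z.1 0) (z.1 1) a) := by
        rw [← expect_jiq_step hz (ψ := fun x y => (x : ℝ) ^ 2 + (y : ℝ) ^ 2)
          (fun x y => by positivity), expect_step, expect_step]
        simp_rw [mismatch_next_eq_empty hz, if_true]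
      rw [h1, ← jiq_drift_sum_sq hA hε hp hm hε2]
      gcongr
      have ho := oneIdle_nonneg (z.1 0) (z.1 1)
      have hb := bothIdle_nonneg (z.1 0) (z.1 1)
      have h2 : 0 ≤ (2 - ε) * (((z.1 0 : ℝ) + z.1 1) * oneIdle (z.1 0) (z.1 1)) := by positivity
      have h3 : 0 ≤ p₀ * oneIdle (z.1 0) (z.1 1) := by positivity
      have h4 : 0 ≤ (1 + p₀) * bothIdle (z.1 0) (z.1 1) := by positivity
      linarith
    · simp [hz]
  · have hfin := (Set.finite_Iic (fun _ : Fin 2 => ⌈(R : ℝ) / ε⌉₊)).prod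
      (Set.finite_univ (α := Finset (Fin 2)))
    refine hfin.subset fun z hz => ?_
    simp only [Set.mem_ofPred_eq] at hz
    rw [← ENNReal.ofReal_natCast R, ENNReal.ofReal_le_ofReal_iff (by positivity)] at hz
    have h1 : (z.1 0 : ℝ) + z.1 1 ≤ (R : ℝ) / ε := by
      rw [le_div_iff₀ hε]
      linarith
    have h2 : ((z.1 0 + z.1 1 : ℕ) : ℝ) ≤ ⌈(R : ℝ) / ε⌉₊ := by
      push_cast
      exact h1.trans (Nat.le_ceil _)
    have h3 : z.1 0 + z.1 1 ≤ ⌈(R : ℝ) / ε⌉₊ := by exact_mod_cast h2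
    refine ⟨fun i => ?_, Set.mem_univ _⟩
    fin_cases i
    · exact le_trans le_self_add h3
    · exact le_trans le_add_self h3
  · have : mismatch (fun _ => 0, Finset.univ) = ∅ := by simp [mismatch]
    simp [this]

theorem meanTotalQueue_eq (π : PMF (State 2)) :
    meanTotalQueue π = expect π fun z => ENNReal.ofReal ((z.1 0 : ℝ) + z.1 1) := by
  refine expect_congr fun z _ => ?_
  rw [ENNReal.ofReal_add (by positivity) (by positivity)]
  simp

variable {π : PMF (State 2)}

theorem meanTotalQueue_ne_top (hA : HasMoments A ε p₀ m₂ m₃) (hε : 0 < ε) (hε2 : ε ≤ 2)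
    (hp : 0 < p₀) (hm : 0 ≤ m₂) (hπ : IsStationary ((jiq 2).step A unitService) π)
    (hsync : ∀ z, π z ≠ 0 → mismatch z = ∅) : meanTotalQueue π ≠ ∞ := by
  have hε2' : 0 ≤ 2 - ε := by linarith
  rw [meanTotalQueue_eq]
  refine expect_ne_top_of_ofReal_mul hε (b := ENNReal.ofReal (m₂ + 2)) (by finiteness)
    (hπ.expect_le_of_foster (V := fun z => ENNReal.ofReal ((z.1 0 : ℝ) ^ 2 + (z.1 1 : ℝ) ^ 2))
      (by finiteness) fun z hz => ?_)
  rw [expect_jiq_step (hsync z hz) (ψ := fun x y => (x : ℝ) ^ 2 + (y : ℝ) ^ 2)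
    (fun x y => by positivity), ← jiq_drift_sum_sq hA hε hp hm hε2]
  gcongr
  have ho := oneIdle_nonneg (z.1 0) (z.1 1)
  have hb := bothIdle_nonneg (z.1 0) (z.1 1)
  have h2 : 0 ≤ (2 - ε) * (((z.1 0 : ℝ) + z.1 1) * oneIdle (z.1 0) (z.1 1)) := by positivity
  have h3 : 0 ≤ p₀ * oneIdle (z.1 0) (z.1 1) := by positivity
  have h4 : 0 ≤ (1 + p₀) * bothIdle (z.1 0) (z.1 1) := by positivity
  linarith

theorem secondMoment_jiq_ne_top (hA : HasMoments A ε p₀ m₂ m₃) (hε : 0 < ε) (hε2 : ε ≤ 2)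
    (hp : 0 < p₀) (hm : 0 ≤ m₂) (hπ : IsStationary ((jiq 2).step A unitService) π)
    (hsync : ∀ z, π z ≠ 0 → mismatch z = ∅) :
    expect π (fun z => ENNReal.ofReal ((z.1 0 : ℝ) ^ 2 + (z.1 1 : ℝ) ^ 2)) ≠ ∞ := by
  refine expect_ne_top_of_ofReal_mul hε
    (b := ENNReal.ofReal (9 * (m₂ - 2 * ε + 2) ^ 2 / (4 * ε) + |m₃| + 3 * m₂ + p₀ + 10))
    (by finiteness)
    (hπ.expect_le_of_foster (V := fun z => ENNReal.ofReal ((z.1 0 : ℝ) ^ 3 + (z.1 1 : ℝ) ^ 3))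
      (by finiteness) fun z hz => ?_)
  rw [expect_jiq_step (hsync z hz) (ψ := fun x y => (x : ℝ) ^ 3 + (y : ℝ) ^ 3)
    (fun x y => by positivity)]
  exact jiq_drift_sum_cube hA hε hp hm hε2 _ _

theorem expect_ofReal_add {α : Type*} (p : PMF α) {f g : α → ℝ} (hf : ∀ x, 0 ≤ f x)
    (hg : ∀ x, 0 ≤ g x) {a b : ℝ} (ha : 0 ≤ a) (hb : 0 ≤ b)
    (hfa : expect p (fun x => ENNReal.ofReal (f x)) = ENNReal.ofReal a)
    (hgb : expect p (fun x => ENNReal.ofReal (g x)) = ENNReal.ofReal b) :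
    expect p (fun x => ENNReal.ofReal (f x + g x)) = ENNReal.ofReal (a + b) := by
  simp_rw [ENNReal.ofReal_add (hf _) (hg _)]
  rw [expect_add, hfa, hgb, ENNReal.ofReal_add ha hb]

theorem expect_ofReal_const_mul {α : Type*} (p : PMF α) {f : α → ℝ} {a c : ℝ} (hc : 0 ≤ c)
    (hfa : expect p (fun x => ENNReal.ofReal (f x)) = ENNReal.ofReal a) :
    expect p (fun x => ENNReal.ofReal (c * f x)) = ENNReal.ofReal (c * a) := by
  simp_rw [ENNReal.ofReal_mul hc]
  rw [expect_const_mul, hfa]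

/-- The stationary equations of the total queue length, of its square, and of the sum of squares,
in terms of the mean total queue length `X`, its part `D` on the event that exactly one server is
idle, and the probabilities `O` and `E` of exactly one and of two idle servers. -/
theorem jiq_stationary_equations (hA : HasMoments A ε p₀ m₂ m₃) (hε : 0 < ε) (hε2 : ε ≤ 2)
    (hp : 0 < p₀) (hm : 0 ≤ m₂) (hπ : IsStationary ((jiq 2).step A unitService) π)
    (hsync : ∀ z, π z ≠ 0 → mismatch z = ∅) :
    ∃ X D O E : ℝ, 0 ≤ X ∧ 0 ≤ D ∧ 0 ≤ O ∧ 0 ≤ E ∧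
      meanTotalQueue π = ENNReal.ofReal X ∧
      expect π (fun z => ENNReal.ofReal
        (((z.1 0 : ℝ) + z.1 1) * oneIdle (z.1 0) (z.1 1))) = ENNReal.ofReal D ∧
      expect π (fun z => ENNReal.ofReal (oneIdle (z.1 0) (z.1 1))) = ENNReal.ofReal O ∧
      ε = p₀ * O + (1 + p₀) * E ∧
      2 * ε * X + 3 * p₀ * O + (p₀ + 2 * ε) * E = m₂ + 2 * p₀ * D + E ∧
      2 * ε + ε * X + (2 - ε) * D + p₀ * O + (1 + p₀) * E = m₂ + 2 := by
  have hε2' : 0 ≤ 2 - ε := by linarith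
  have hreal : ∀ {f : State 2 → ℝ}, expect π (fun z => ENNReal.ofReal (f z)) ≠ ∞ →
      ∃ r : ℝ, 0 ≤ r ∧ expect π (fun z => ENNReal.ofReal (f z)) = ENNReal.ofReal r :=
    fun h => ⟨_, ENNReal.toReal_nonneg, (ENNReal.ofReal_toReal h).symm⟩
  have hXfin := meanTotalQueue_ne_top hA hε hε2 hp hm hπ hsync
  have hWfin := secondMoment_jiq_ne_top hA hε hε2 hp hm hπ hsync
  have ho1 : ∀ z : State 2, oneIdle (z.1 0) (z.1 1) ≤ 1 := fun z => by
    unfold oneIdle; split_ifs <;> norm_num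
  have hb1 : ∀ z : State 2, bothIdle (z.1 0) (z.1 1) ≤ 1 := fun z => by
    unfold bothIdle; split_ifs <;> norm_num
  have ho : ∀ z : State 2, 0 ≤ oneIdle (z.1 0) (z.1 1) := fun z => oneIdle_nonneg _ _
  have hb : ∀ z : State 2, 0 ≤ bothIdle (z.1 0) (z.1 1) := fun z => bothIdle_nonneg _ _
  have htot : ∀ z : State 2, 0 ≤ (z.1 0 : ℝ) + z.1 1 := fun z => by positivity
  rw [meanTotalQueue_eq] at hXfin ⊢
  have hSfin : expect π (fun z => ENNReal.ofReal (((z.1 0 : ℝ) + z.1 1) ^ 2)) ≠ ∞ := by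
    refine ne_top_of_le_ne_top (ENNReal.mul_ne_top (by simp : (2 : ℝ≥0∞) ≠ ∞) hWfin) ?_
    rw [← expect_const_mul]
    refine expect_mono fun z _ => ?_
    have h20 : (2 : ℝ≥0∞) = ENNReal.ofReal 2 := by norm_num
    rw [h20, ← ENNReal.ofReal_mul (by norm_num)]
    refine ENNReal.ofReal_le_ofReal ?_
    nlinarith [sq_nonneg ((z.1 0 : ℝ) - z.1 1)]
  obtain ⟨X, hX0, hX⟩ := hreal hXfin
  obtain ⟨D, hD0, hD⟩ := hreal (ne_top_of_le_ne_top hXfin (expect_mono fun z _ =>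
    ENNReal.ofReal_le_ofReal (mul_le_of_le_one_right (htot z) (ho1 z))))
  have hone : expect π (fun _ => ENNReal.ofReal 1) ≠ ∞ := by simp [expect_const]
  obtain ⟨O, hO0, hO⟩ := hreal (ne_top_of_le_ne_top hone (expect_mono fun z _ =>
    ENNReal.ofReal_le_ofReal (ho1 z)))
  obtain ⟨E, hE0, hE⟩ := hreal (ne_top_of_le_ne_top hone (expect_mono fun z _ =>
    ENNReal.ofReal_le_ofReal (hb1 z)))
  refine ⟨X, D, O, E, hX0, hD0, hO0, hE0, hX, hD, hO, ?_, ?_, ?_⟩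
  · have h := hπ.expect_eq_of_drift hXfin fun z hz => by
      rw [expect_jiq_step (hsync z hz) (ψ := fun x y => (x : ℝ) + y) (fun x y => by positivity)]
      exact jiq_drift_total hA hε hp (z.1 0) (z.1 1)
    rw [expect_const, expect_ofReal_add π (fun z => mul_nonneg hp.le (ho z))
      (fun z => mul_nonneg (by positivity) (hb z)) (by positivity) (by positivity)
      (expect_ofReal_const_mul π hp.le hO) (expect_ofReal_const_mul π (by positivity) hE)] at h
    rwa [ENNReal.ofReal_eq_ofReal_iff hε.le (by positivity)] at h
  · have h := hπ.expect_eq_of_drift hSfin fun z hz => by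
      rw [expect_jiq_step (hsync z hz) (ψ := fun x y => ((x : ℝ) + y) ^ 2)
        (fun x y => by positivity)]
      exact jiq_drift_total_sq hA hε hp hm (z.1 0) (z.1 1)
    have hl := expect_ofReal_add π
      (fun z => add_nonneg (mul_nonneg (by positivity : 0 ≤ 2 * ε) (htot z))
        (mul_nonneg (by positivity : 0 ≤ 3 * p₀) (ho z)))
      (fun z => mul_nonneg (by positivity : 0 ≤ p₀ + 2 * ε) (hb z))
      (by positivity) (by positivity)
      (expect_ofReal_add π (fun z => mul_nonneg (by positivity) (htot z))
        (fun z => mul_nonneg (by positivity) (ho z)) (by positivity) (by positivity)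
        (expect_ofReal_const_mul π (by positivity) hX)
        (expect_ofReal_const_mul π (by positivity) hO))
      (expect_ofReal_const_mul π (by positivity) hE)
    have hr := expect_ofReal_add π
      (fun z => add_nonneg hm (mul_nonneg (by positivity : 0 ≤ 2 * p₀)
        (mul_nonneg (htot z) (ho z)))) hb
      (by positivity) (by positivity)
      (expect_ofReal_add π (fun _ => hm)
        (fun z => mul_nonneg (by positivity) (mul_nonneg (htot z) (ho z))) hm (by positivity)
        (expect_const π _) (expect_ofReal_const_mul π (by positivity) hD)) hE
    rw [hl, hr] at h
    rwa [ENNReal.ofReal_eq_ofReal_iff (by positivity) (by positivity)] at h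
  · have h := hπ.expect_eq_of_drift hWfin fun z hz => by
      rw [expect_jiq_step (hsync z hz) (ψ := fun x y => (x : ℝ) ^ 2 + (y : ℝ) ^ 2)
        (fun x y => by positivity)]
      exact jiq_drift_sum_sq hA hε hp hm hε2 (z.1 0) (z.1 1)
    have n1 : ∀ z : State 2, 0 ≤ 2 * ε + ε * ((z.1 0 : ℝ) + z.1 1) := fun z => by positivity
    have n2 : ∀ z : State 2, 0 ≤ (2 - ε) * (((z.1 0 : ℝ) + z.1 1) * oneIdle (z.1 0) (z.1 1)) :=
      fun z => mul_nonneg hε2' (mul_nonneg (htot z) (ho z))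
    have n3 : ∀ z : State 2, 0 ≤ p₀ * oneIdle (z.1 0) (z.1 1) := fun z => mul_nonneg hp.le (ho z)
    have n4 : ∀ z : State 2, 0 ≤ (1 + p₀) * bothIdle (z.1 0) (z.1 1) :=
      fun z => mul_nonneg (by positivity) (hb z)
    have hl1 := expect_ofReal_add π (fun _ => (by positivity : 0 ≤ 2 * ε))
      (fun z => mul_nonneg hε.le (htot z)) (by positivity) (by positivity)
      (expect_const π _) (expect_ofReal_const_mul π hε.le hX)
    have hl2 := expect_ofReal_add π n1 n2 (by positivity) (by positivity) hl1
      (expect_ofReal_const_mul π hε2' hD)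
    have hl3 := expect_ofReal_add π (fun z => add_nonneg (n1 z) (n2 z)) n3 (by positivity)
      (by positivity) hl2 (expect_ofReal_const_mul π hp.le hO)
    have hl4 := expect_ofReal_add π (fun z => add_nonneg (add_nonneg (n1 z) (n2 z)) (n3 z)) n4
      (by positivity) (by positivity) hl3 (expect_ofReal_const_mul π (by positivity) hE)
    rw [hl4, expect_const] at h
    rwa [ENNReal.ofReal_eq_ofReal_iff (by positivity) (by positivity)] at h

/-- Slots without arrivals in which exactly one server is idle contribute to the cross term. -/
theorem le_crossTerm_add (hzero : A 0 = ENNReal.ofReal p₀) :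
    ENNReal.ofReal p₀ * expect π (fun z => ENNReal.ofReal
        (((z.1 0 : ℝ) + z.1 1) * oneIdle (z.1 0) (z.1 1))) ≤
      crossTerm (jiq 2) A unitService π +
        ENNReal.ofReal p₀ * expect π (fun z => ENNReal.ofReal (oneIdle (z.1 0) (z.1 1))) := by
  rw [crossTerm, ← expect_const_mul, ← expect_const_mul, ← expect_add]
  refine expect_mono fun z _ => ?_
  by_cases h : (z.1 0 = 0 ∧ z.1 1 ≠ 0) ∨ (z.1 0 ≠ 0 ∧ z.1 1 = 0)
  · rw [oneIdle, if_pos h, mul_one, ENNReal.ofReal_one, mul_one, expect_slotLaw]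
    refine le_trans ?_ (add_le_add_left (le_expect A _ 0) _)
    rw [hzero]
    have hslot : ∀ n : Fin 2,
        (∑ i, (nextQueue z.1 (0, n, fun _ => 1) i : ℝ≥0∞)) *
          (∑ i, (unused z.1 (0, n, fun _ => 1) i : ℝ≥0∞)) =
        ((z.1 0 + z.1 1 - 1 : ℕ) : ℝ≥0∞) := by
      intro n
      simp only [nextQueue, unused, ite_self, add_zero, Fin.sum_univ_two]
      norm_cast
      rcases h with ⟨h0, h1⟩ | ⟨h0, h1⟩
      · have h2 : 1 - z.1 1 = 0 := by omega
        simp [h0, h2]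
      · have h2 : 1 - z.1 0 = 0 := by omega
        simp [h1, h2]
    simp_rw [hslot]
    rw [expect_const]
    nth_rewrite 3 [← mul_one (ENNReal.ofReal p₀)]
    rw [← mul_add]
    gcongr
    rw [← Nat.cast_add, ENNReal.ofReal_natCast]
    norm_cast
    omega
  · simp [oneIdle, h]

end JIQStationary

/-! ### Heavy traffic -/

section HeavyTraffic

variable {p₀ ε₀ σ2 : ℝ} {A : ℝ → PMF ℕ}

theorem IsClassA.slack_le_two (h : IsClassA p₀ ε₀ σ2 A) {ε : ℝ} (hε : ε ∈ Set.Ioo 0 ε₀) :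
    ε ≤ 2 := by
  have h1 := h.mean_eq ε hε
  have h2 : 0 ≤ mean (A ε) := integral_nonneg fun k => by positivity
  linarith

theorem second_moment_nonneg (A : PMF ℕ) (ε : ℝ) : 0 ≤ variance A + ε ^ 2 :=
  add_nonneg (variance_nonneg _ _) (sq_nonneg _)

theorem IsClassA.mismatch_eq_empty (h : IsClassA p₀ ε₀ σ2 A) {ε : ℝ} (hε : ε ∈ Set.Ioo 0 ε₀)
    {π : PMF (State 2)} (hπ : IsStationary ((jiq 2).step (A ε) unitService) π) (z : State 2)
    (hz : π z ≠ 0) : mismatch z = ∅ := by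
  obtain ⟨a, ha0, ha⟩ : ∃ a, a ≠ 0 ∧ A ε a ≠ 0 := by
    by_contra! hall
    have h0 : A ε 0 = 1 := by
      rw [← (A ε).tsum_coe, tsum_eq_single 0 hall]
    rw [h.apply_zero ε hε, ENNReal.ofReal_eq_one] at h0
    exact h.lt_one.ne h0
  exact mismatch_eq_empty_of_isStationary ha0 ha hπ hz

theorem IsClassA.eventually_mem (h : IsClassA p₀ ε₀ σ2 A) : ∀ᶠ ε in 𝓝[>] (0 : ℝ),
    ε ∈ Set.Ioo 0 ε₀ :=
  Ioo_mem_nhdsGT h.pos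

theorem eventually_le_of_pos {c : ℝ} (hc : 0 < c) : ∀ᶠ ε in 𝓝[>] (0 : ℝ), ε ≤ c :=
  mem_of_superset (Ioo_mem_nhdsGT hc) fun _ h => h.2.le

/-- Bounds on the total queue length and the cross term under join-idle-queue for small slack. -/
theorem IsClassA.jiq_bounds (h : IsClassA p₀ ε₀ σ2 A) {ε : ℝ} (hε : ε ∈ Set.Ioo 0 ε₀)
    (hε7 : ε ≤ 1 / 7) {π : PMF (State 2)} (hπ : IsStationary ((jiq 2).step (A ε) unitService) π) :
    ENNReal.ofReal (p₀ / 2 - ε) ≤ crossTerm (jiq 2) (A ε) unitService π ∧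
      ENNReal.ofReal ((variance (A ε) + p₀ - 5 * ε) / 2) ≤ ENNReal.ofReal ε * meanTotalQueue π := by
  obtain ⟨m₃, hA⟩ := h.exists_hasMoments hε
  have hm := second_moment_nonneg (A ε) ε
  have hε0 := hε.1
  have hp := h.p₀_pos
  have hp1 := h.lt_one
  obtain ⟨X, D, O, E, hX0, hD0, hO0, hE0, hX, hD, hO, e1, e2, e3⟩ :=
    jiq_stationary_equations hA hε0 (h.slack_le_two hε) hp hm hπ
      (h.mismatch_eq_empty hε hπ)
  have hv : 0 ≤ LoadBalancing.variance (A ε) := variance_nonneg _ _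
  have hpO : 0 ≤ p₀ * O := by positivity
  have hpE : 0 ≤ p₀ * E := by positivity
  have hεE : 0 ≤ ε * E := by positivity
  have hEε : E ≤ ε := by nlinarith
  have hεE' : ε * E ≤ ε := by nlinarith
  have hεD : 0 ≤ ε * D := by positivity
  have hε2 : 0 ≤ ε ^ 2 := sq_nonneg ε
  -- Eliminating `X` gives `(4 - 2ε + 2p₀) D = m₂ + 4 - 6ε + 3p₀O + (p₀ + 2ε - 1) E`. The right side
  -- is at least `4 - 7ε ≥ 3`, since `E ≤ ε ≤ 1/7`, while `D < 1/2` would make the left side less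
  -- than `3`.
  have hD2 : 1 / 2 ≤ D := by
    by_contra! hlt
    nlinarith
  have hpD : p₀ / 2 ≤ p₀ * D := by nlinarith
  constructor
  · have hc := le_crossTerm_add (π := π) (h.apply_zero ε hε)
    rw [hD, hO, ← ENNReal.ofReal_mul hp.le, ← ENNReal.ofReal_mul hp.le] at hc
    -- The balance of the total queue gives `p₀ O ≤ ε`.
    refine le_trans (ENNReal.ofReal_le_ofReal (by linarith : p₀ / 2 - ε ≤ p₀ * D - p₀ * O)) ?_
    rw [ENNReal.ofReal_sub _ hpO]
    exact tsub_le_iff_right.2 hc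
  · rw [hX, ← ENNReal.ofReal_mul hε0.le]
    refine ENNReal.ofReal_le_ofReal ?_
    nlinarith

theorem IsClassA.eventually_le_crossTerm (h : IsClassA p₀ ε₀ σ2 A) :
    ∀ᶠ ε in 𝓝[>] (0 : ℝ), ∀ π, IsStationary ((jiq 2).step (A ε) unitService) π →
      ENNReal.ofReal (p₀ / 4) ≤ crossTerm (jiq 2) (A ε) unitService π := by
  have hp := h.p₀_pos
  filter_upwards [h.eventually_mem, eventually_le_of_pos (by norm_num : (0 : ℝ) < 1 / 7),
    eventually_le_of_pos (by positivity : 0 < p₀ / 4)] with ε hε hε7 hεp π hπ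
  exact (ENNReal.ofReal_le_ofReal (by linarith)).trans (h.jiq_bounds hε hε7 hπ).1

/-- Of the excess `p₀ / 2`, an eighth of `p₀` is spent on the convergence of the variance and
another eighth on the error `5ε / 2`. -/
theorem IsClassA.eventually_le_meanTotalQueue (h : IsClassA p₀ ε₀ σ2 A) :
    ∀ᶠ ε in 𝓝[>] (0 : ℝ), ∀ π, IsStationary ((jiq 2).step (A ε) unitService) π →
      ENNReal.ofReal (σ2 / 2 + p₀ / 4) ≤ ENNReal.ofReal ε * meanTotalQueue π := by
  have hp := h.p₀_pos
  have hvar := h.tendsto_variance.eventually (lt_mem_nhds (by linarith : σ2 - p₀ / 4 < σ2))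
  filter_upwards [h.eventually_mem, eventually_le_of_pos (by norm_num : (0 : ℝ) < 1 / 7),
    eventually_le_of_pos (by positivity : 0 < p₀ / 20), hvar] with ε hε hε7 hεp hv π hπ
  exact (ENNReal.ofReal_le_ofReal (by linarith)).trans (h.jiq_bounds hε hε7 hπ).2

theorem IsClassA.tendsto_meanQueue (h : IsClassA p₀ ε₀ σ2 A) {ρ : ℝ → PMF ℕ}
    (hρ : ∀ ε ∈ Set.Ioo 0 ε₀, IsStationary (pooledStep (A ε) unitService) (ρ ε)) :
    Tendsto (fun ε => ENNReal.ofReal ε * meanQueue (ρ ε)) (𝓝[>] 0)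
      (𝓝 (ENNReal.ofReal (σ2 / 2))) := by
  have hid : Tendsto (fun ε : ℝ => ε) (𝓝[>] 0) (𝓝 0) := tendsto_id.mono_left nhdsWithin_le_nhds
  have hup : Tendsto (fun ε => (variance (A ε) + ε ^ 2) / 2) (𝓝[>] 0) (𝓝 (σ2 / 2)) := by
    simpa using (h.tendsto_variance.add (hid.pow 2)).div_const 2
  have hlo : Tendsto (fun ε => (variance (A ε) + ε ^ 2) / 2 - ε) (𝓝[>] 0) (𝓝 (σ2 / 2)) := by
    simpa using hup.sub hid
  have hb : ∀ᶠ ε in 𝓝[>] (0 : ℝ),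
      ENNReal.ofReal ((variance (A ε) + ε ^ 2) / 2 - ε) ≤ ENNReal.ofReal ε * meanQueue (ρ ε) ∧
        ENNReal.ofReal ε * meanQueue (ρ ε) ≤ ENNReal.ofReal ((variance (A ε) + ε ^ 2) / 2) := by
    filter_upwards [h.eventually_mem] with ε hε
    obtain ⟨m₃, hA⟩ := h.exists_hasMoments hε
    exact meanQueue_bounds hA hε.1 (h.slack_le_two hε) (second_moment_nonneg _ _) (hρ ε hε)
  exact tendsto_of_tendsto_of_tendsto_of_le_of_le' (ENNReal.tendsto_ofReal hlo)
    (ENNReal.tendsto_ofReal hup) (hb.mono fun _ h => h.1) (hb.mono fun _ h => h.2)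

theorem IsClassA.exists_isStationary_jiq (h : IsClassA p₀ ε₀ σ2 A) {ε : ℝ}
    (hε : ε ∈ Set.Ioo 0 ε₀) : ∃ π, IsStationary ((jiq 2).step (A ε) unitService) π := by
  obtain ⟨m₃, hA⟩ := h.exists_hasMoments hε
  exact LoadBalancing.exists_isStationary_jiq hA hε.1 (h.slack_le_two hε) h.p₀_pos
    (second_moment_nonneg _ _)

theorem IsClassA.exists_isStationary_pooledStep (h : IsClassA p₀ ε₀ σ2 A) {ε : ℝ}
    (hε : ε ∈ Set.Ioo 0 ε₀) : ∃ ρ, IsStationary (pooledStep (A ε) unitService) ρ := by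
  obtain ⟨m₃, hA⟩ := h.exists_hasMoments hε
  exact LoadBalancing.exists_isStationary_pooledStep hA hε.1 (second_moment_nonneg _ _)

end HeavyTraffic

/-! ### An arrival family of the class -/

section Family

/-- Weights of the arrival law on `{0, 1, 11}` with mean `2 - ε` and `P (A = 0) = 1 / 2`. -/
def threePointWeight (ε : ℝ) (k : ℕ) : ℝ :=
  if k = 0 then 1 / 2 else if k = 1 then (7 + 2 * ε) / 20 else if k = 11 then (3 - 2 * ε) / 20
  else 0

/-- For slack `0 < ε < 1` the law with weights `threePointWeight ε`. -/
def threePointLaw (ε : ℝ) : PMF ℕ :=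
  if h : 0 < ε ∧ ε < 1 then
    PMF.ofFinset (fun k => ENNReal.ofReal (threePointWeight ε k)) {0, 1, 11}
      (by
        have h1 := h.1
        have h2 := h.2
        simp only [threePointWeight]
        rw [Finset.sum_insert (by simp), Finset.sum_insert (by simp), Finset.sum_singleton,
          ← ENNReal.ofReal_add, ← ENNReal.ofReal_add, ENNReal.ofReal_eq_one] <;> norm_num <;>
            linarith)
      (fun k hk => by
        simp only [Finset.mem_insert, Finset.mem_singleton, not_or] at hk
        simp [threePointWeight, hk])
  else PMF.pure 0

variable {ε : ℝ}

theorem threePointLaw_apply (hε : ε ∈ Set.Ioo (0 : ℝ) 1) (k : ℕ) :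
    threePointLaw ε k = ENNReal.ofReal (threePointWeight ε k) := by
  rw [threePointLaw, dif_pos ⟨hε.1, hε.2⟩, PMF.ofFinset_apply]

theorem boundedBy_threePointLaw (hε : ε ∈ Set.Ioo (0 : ℝ) 1) : BoundedBy (threePointLaw ε) 11 := by
  intro k hk
  by_contra! hlt
  refine hk ?_
  rw [threePointLaw_apply hε]
  rw [threePointWeight, if_neg (by omega), if_neg (by omega), if_neg (by omega), ENNReal.ofReal_zero]

theorem integral_threePointLaw (hε : ε ∈ Set.Ioo (0 : ℝ) 1) (g : ℕ → ℝ) :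
    ∫ k, g k ∂(threePointLaw ε).toMeasure =
      1 / 2 * g 0 + (7 + 2 * ε) / 20 * g 1 + (3 - 2 * ε) / 20 * g 11 := by
  have h1 := hε.1
  have h2 := hε.2
  rw [(boundedBy_threePointLaw hε).integral_eq]
  simp only [Finset.sum_range_succ, Finset.sum_range_zero, threePointLaw_apply hε,
    threePointWeight]
  norm_num
  rw [ENNReal.toReal_ofReal (by linarith), ENNReal.toReal_ofReal (by linarith)]

/-- The second moment is `37/2 - 12ε`, so the limiting variance is `37/2 - 4 = 29/2`, above the
threshold `8 / p₀ - 4 = 12`. -/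
theorem isClassA_threePointLaw : IsClassA (1 / 2) 1 (29 / 2) threePointLaw where
  pos := one_pos
  bounded ε hε := ⟨11, boundedBy_threePointLaw hε⟩
  mean_eq ε hε := by
    rw [mean, integral_threePointLaw hε]
    push_cast
    ring
  tendsto_variance := by
    have hlim : Tendsto (fun ε : ℝ => 37 / 2 - 12 * ε - (2 - ε) ^ 2) (𝓝[>] 0) (𝓝 (29 / 2)) := by
      refine Tendsto.mono_left ?_ nhdsWithin_le_nhds
      have : Continuous fun ε : ℝ => 37 / 2 - 12 * ε - (2 - ε) ^ 2 := by fun_prop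
      convert this.tendsto 0 using 2
      norm_num
    refine hlim.congr' ?_
    filter_upwards [Ioo_mem_nhdsGT one_pos] with ε hε
    rw [LoadBalancing.variance, variance_eq_integral (measurable_of_countable _).aemeasurable,
      integral_threePointLaw hε fun k => (k : ℝ), integral_threePointLaw hε]
    push_cast
    ring
  p₀_pos := by norm_num
  apply_zero ε hε := by simp [threePointLaw_apply hε, threePointWeight]
  lt_variance := by norm_num

end Family

/-- Join-idle-queue with two unit servers is not delay optimal. -/
theorem not_delayOptimalHomogeneous_jiq : ¬ DelayOptimalHomogeneous (jiq 2) := by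
  intro hopt
  have hA := isClassA_threePointLaw
  have hν : BoundedBy (PMF.pure 1) 1 := fun k hk => by
    rw [PMF.pure_apply] at hk
    by_contra! hlt
    exact hk (if_neg (by omega))
  have hmean : ∑ _n : Fin 2, mean (PMF.pure 1) = 2 := by
    simp [mean, PMF.toMeasure_pure]
  obtain ⟨-, hlim⟩ := hopt (PMF.pure 1) ⟨1, hν⟩ 1 (29 / 2) threePointLaw
    (by rw [hmean]; exact hA.toIsArrivalFamily) ⟨11, fun ε hε => boundedBy_threePointLaw hε⟩
  -- Outside `(0, 1)` any law serves as a filler, since the limits only see small positive slack.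
  have hπ : ∀ ε : ℝ, ∃ π, ε ∈ Set.Ioo (0 : ℝ) 1 →
      IsStationary ((jiq 2).step (threePointLaw ε) unitService) π := fun ε => by
    by_cases hε : ε ∈ Set.Ioo (0 : ℝ) 1
    · obtain ⟨π, h⟩ := hA.exists_isStationary_jiq hε
      exact ⟨π, fun _ => h⟩
    · exact ⟨PMF.pure (fun _ => 0, ∅), fun h => absurd h hε⟩
  have hρ : ∀ ε : ℝ, ∃ ρ, ε ∈ Set.Ioo (0 : ℝ) 1 →
      IsStationary (pooledStep (threePointLaw ε) unitService) ρ := fun ε => by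
    by_cases hε : ε ∈ Set.Ioo (0 : ℝ) 1
    · obtain ⟨ρ, h⟩ := hA.exists_isStationary_pooledStep hε
      exact ⟨ρ, fun _ => h⟩
    · exact ⟨PMF.pure 0, fun h => absurd h hε⟩
  choose π hπ using hπ
  choose ρ hρ using hρ
  obtain ⟨L, hL, hL'⟩ := hlim π ρ hπ hρ
  have h1 : L = ENNReal.ofReal (29 / 2 / 2) :=
    tendsto_nhds_unique hL' (hA.tendsto_meanQueue hρ)
  have h2 : ENNReal.ofReal (29 / 2 / 2 + 1 / 2 / 4) ≤ L := by
    refine ge_of_tendsto hL ?_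
    filter_upwards [hA.eventually_mem, hA.eventually_le_meanTotalQueue] with ε hε h
    exact h _ (hπ ε hε)
  rw [h1, ENNReal.ofReal_le_ofReal_iff (by norm_num)] at h2
  norm_num at h2

end LoadBalancing

end

theorem theorem2 :
    ¬ LoadBalancing.DelayOptimalHomogeneous (LoadBalancing.jiq 2) ∧
    ∀ (p₀ ε₀ σ2 : ℝ) (A : ℝ → PMF ℕ), LoadBalancing.IsClassA p₀ ε₀ σ2 A →
      -- steady states exist, with finite mean queue lengths
      (∀ ε ∈ Set.Ioo 0 ε₀,
        (∃ π, LoadBalancing.IsStationary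
          ((LoadBalancing.jiq 2).step (A ε) LoadBalancing.unitService) π) ∧
        (∃ ρ, LoadBalancing.IsStationary
          (LoadBalancing.pooledStep (A ε) LoadBalancing.unitService) ρ) ∧
        (∀ π, LoadBalancing.IsStationary
          ((LoadBalancing.jiq 2).step (A ε) LoadBalancing.unitService) π →
          LoadBalancing.meanTotalQueue π ≠ ∞) ∧
        (∀ ρ, LoadBalancing.IsStationary
          (LoadBalancing.pooledStep (A ε) LoadBalancing.unitService) ρ →
          LoadBalancing.meanQueue ρ ≠ ∞)) ∧
      -- the cross term stays bounded away from zero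
      (∃ b : ℝ, 0 < b ∧ ∀ᶠ ε in 𝓝[>] (0 : ℝ), ∀ π,
        LoadBalancing.IsStationary
          ((LoadBalancing.jiq 2).step (A ε) LoadBalancing.unitService) π →
        ENNReal.ofReal b ≤
          LoadBalancing.crossTerm (LoadBalancing.jiq 2) (A ε) LoadBalancing.unitService π) ∧
      -- the heavy-traffic limit of the resource-pooled system
      (∀ ρ : ℝ → PMF ℕ,
        (∀ ε ∈ Set.Ioo 0 ε₀, LoadBalancing.IsStationary
          (LoadBalancing.pooledStep (A ε) LoadBalancing.unitService) (ρ ε)) →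
        Tendsto (fun ε => ENNReal.ofReal ε * LoadBalancing.meanQueue (ρ ε)) (𝓝[>] 0)
          (𝓝 (ENNReal.ofReal (σ2 / 2)))) ∧
      -- it is not reached under join-idle-queue
      (∃ c : ℝ, 0 < c ∧ ∀ᶠ ε in 𝓝[>] (0 : ℝ), ∀ π,
        LoadBalancing.IsStationary
          ((LoadBalancing.jiq 2).step (A ε) LoadBalancing.unitService) π →
        ENNReal.ofReal (σ2 / 2 + c) ≤ ENNReal.ofReal ε * LoadBalancing.meanTotalQueue π) := by
  refine ⟨LoadBalancing.not_delayOptimalHomogeneous_jiq, fun p₀ ε₀ σ2 A h => ?_⟩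
  refine ⟨fun ε hε => ⟨h.exists_isStationary_jiq hε, h.exists_isStationary_pooledStep hε,
    fun π hπ => ?_, fun ρ hρ => ?_⟩, ⟨p₀ / 4, by linarith [h.p₀_pos], h.eventually_le_crossTerm⟩,
    fun ρ hρ => h.tendsto_meanQueue hρ,
    ⟨p₀ / 4, by linarith [h.p₀_pos], h.eventually_le_meanTotalQueue⟩⟩
  · obtain ⟨m₃, hA⟩ := h.exists_hasMoments hε
    exact LoadBalancing.meanTotalQueue_ne_top hA hε.1 (h.slack_le_two hε) h.p₀_pos
      (LoadBalancing.second_moment_nonneg _ _) hπ (h.mismatch_eq_empty hε hπ)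
  · obtain ⟨m₃, hA⟩ := h.exists_hasMoments hε
    exact LoadBalancing.meanQueue_ne_top hA hε.1 (LoadBalancing.second_moment_nonneg _ _) hρ
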